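/- **Definitions.** A *simplicial $\mathbb R$-tree* is a simplicial tree (a nonempty connected graph without circuits) endowed with a distance $d$ for which the image of every injective path is isometric to a real segment; edges need not all have the same length. It has valence $\ge 2$ if every vertex has at least two neighbours. $\mathrm{Isom}(X)$ is the group of bijective isometries of $X$ mapping vertices to vertices and edges to edges, with the topology for which the pointwise stabilizers of compact subsets of $X$ form a basis of neighbourhoods of the identity. For $g\in\mathrm{Isom}(X)$ put $\lambda(g)=\inf_{x\in X}d(x,g\cdot x)$. A map $f:X\to X'$ between simplicial $\mathbb R$-trees is *piecewise affine* if for every edge $e$ of $X$ there is a constant $C_e\ge 0$ with $d(f(x_1),f(x_2))=C_e\,d(x_1,x_2)$ for all $x_1,x_2\in e$. **Proposition.** Let $X$ and $X'$ be simplicial $\mathbb R$-trees of valence $\ge 2$, with $X$ locally finite. Let $\Gamma_0$ be a discrete torsion-free subgroup of $\mathrm{Isom}(X)$ such that the quotient graph $\Gamma_0\backslash X$ is finite, and let $\rho:\Gamma_0\to\mathrm{Isom}(X')$ be a group homomorphism. 1. There exists a piecewise affine map $f:X\to X'$ that is $\rho$-equivariant, i.e. $f(\gamma\cdot x)=\rho(\gamma)\cdot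 f(x)$ for all $\gamma\in\Gamma_0$ and $x\in X$. Every such map is Lipschitz. 2. The infimum $C\ge 0$ of the Lipschitz constants of such maps is attained. 3. One has $\lambda(\gamma)>0$ for all $\gamma\in\Gamma_0\smallsetminus\{1\}$. Let $N\ge 1$ be the number of vertices of $\Gamma_0\backslash X$, let $L$ be a real number such that every edge of $X$ has length $\le L$ (for instance the maximal length of an edge, which exists because $\Gamma_0\backslash X$ is finite; or $L=1$ if all edges have length $\leq 1$), let $x_0\in X$ be any point, and let $F$ be the set of all $\gamma\in\Gamma_0\smallsetminus\{1\}$ such that $d(x_0,\gamma\cdot x_0)\le 4NL$. Then $F$ is finite and $$\sup_{\gamma\in\Gamma_0\smallsetminus\{1\}}\frac{\lambda(\rho(\gamma))}{\lambda(\gamma)}\;=\;\max_{\gamma\in F}\frac{\lambda(\rho(\gamma))}{\lambda(\gamma)}\;=\;C.$$ -/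

import Mathlib

open scoped NNReal

/-- The metric segment between two points of a metric space. -/
def metricSegment {X : Type*} [MetricSpace X] (x y : X) : Set X :=
  {z | dist x z + dist z y = dist x y}

/-- A simplicial real tree: a metric space `X` which is the realization of a simplicial tree
(in the sense of Serre: a nonempty connected graph without circuits), in which the image of every
injective path is isometric to a real segment; edges may have different lengths.

`verts` is the set of vertices, regarded as points of `X`, and `graph` is the underlying
combinatorial tree. The (closed) edge joining two adjacent vertices `v`, `w` is
`metricSegment v w`. The last two fields say that the distance between two points is the length
of the injective path joining them: for two vertices it is the sum of the lengths of the edges on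
the reduced path between them, and for points `x`, `y` of two distinct edges the path from `x` to
`y` leaves the first edge by one of its ends and enters the second edge by one of its ends.
(In particular distinct edges meet at most at a common end.) -/
structure SimplicialRealTree (X : Type*) [MetricSpace X] where
  verts : Set X
  graph : SimpleGraph verts
  isTree : graph.IsTree
  exists_mem_edge : ∀ x : X, x ∈ verts ∨
    ∃ v w : verts, graph.Adj v w ∧ x ∈ metricSegment (v : X) (w : X)
  edge_isometric : ∀ v w : verts, graph.Adj v w →
    Nonempty (Set.Icc (0 : ℝ) (dist (v : X) (w : X)) ≃ᵢ metricSegment (v : X) (w : X))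
  dist_verts : ∀ (v w : verts) (p : graph.Walk v w), p.IsPath →
    dist (v : X) (w : X) = (p.darts.map fun d => dist (d.fst : X) (d.snd : X)).sum
  dist_edges : ∀ v w v' w' : verts, graph.Adj v w → graph.Adj v' w' → s(v, w) ≠ s(v', w') →
    ∀ x ∈ metricSegment (v : X) (w : X), ∀ y ∈ metricSegment (v' : X) (w' : X),
      ∃ a b : verts, (a = v ∨ a = w) ∧ (b = v' ∨ b = w') ∧
        dist x y = dist x (a : X) + dist (a : X) (b : X) + dist (b : X) y

namespace SimplicialRealTree

variable {X X' : Type*} [MetricSpace X] [MetricSpace X']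

/-- Every vertex has at least two neighbours. -/
def ValenceGeTwo (T : SimplicialRealTree X) : Prop :=
  ∀ v : T.verts, ∃ w₁ w₂ : T.verts, w₁ ≠ w₂ ∧ T.graph.Adj v w₁ ∧ T.graph.Adj v w₂

/-- Every vertex has finitely many neighbours. -/
def LocallyFinite (T : SimplicialRealTree X) : Prop :=
  ∀ v : T.verts, (T.graph.neighborSet v).Finite

/-- The group `Isom(X)` of bijective isometries of `X` mapping vertices to vertices and edges to
edges, i.e. those that restrict to an automorphism of the underlying graph. -/
def Isom (T : SimplicialRealTree X) : Subgroup (X ≃ᵢ X) where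
  carrier := {g | ∃ φ : T.graph ≃g T.graph, ∀ v : T.verts, g (v : X) = (φ v : X)}
  one_mem' := ⟨SimpleGraph.Iso.refl, fun _ => rfl⟩
  mul_mem' := by
    rintro g h ⟨φ, hφ⟩ ⟨ψ, hψ⟩
    exact ⟨φ.comp ψ, fun v => by simp [IsometryEquiv.mul_apply, hψ, hφ]⟩
  inv_mem' := by
    rintro g ⟨φ, hφ⟩
    refine ⟨φ.symm, fun v => ?_⟩
    apply g.injective
    rw [IsometryEquiv.apply_inv_self, hφ]
    simp

/-- The topology on `Isom(X)` for which the pointwise stabilizers of compact subsets of `X` form a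
neighbourhood basis of the identity: a set `U` is open if around each `g ∈ U` it contains
some coset `g · Fix(K)` with `K` compact. -/
instance isomTopology (T : SimplicialRealTree X) : TopologicalSpace T.Isom where
  IsOpen U := ∀ g ∈ U, ∃ K : Set X, IsCompact K ∧
    ∀ h : T.Isom, (∀ x ∈ K, (h : X ≃ᵢ X) x = (g : X ≃ᵢ X) x) → h ∈ U
  isOpen_univ := fun _ _ => ⟨∅, isCompact_empty, fun _ _ => trivial⟩
  isOpen_inter := by
    intro U V hU hV g hg
    obtain ⟨K, hK, hK'⟩ := hU g hg.1
    obtain ⟨L, hL, hL'⟩ := hV g hg.2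
    exact ⟨K ∪ L, hK.union hL, fun h hh =>
      ⟨hK' h fun x hx => hh x (Or.inl hx), hL' h fun x hx => hh x (Or.inr hx)⟩⟩
  isOpen_sUnion := by
    intro S hS g hg
    obtain ⟨U, hU, hgU⟩ := hg
    obtain ⟨K, hK, hK'⟩ := hS U hU g hgU
    exact ⟨K, hK, fun h hh => ⟨U, hU, hK' h hh⟩⟩

/-- Two vertices are equivalent if they lie in the same orbit of `Γ`. -/
def vertexSetoid (T : SimplicialRealTree X) (Γ : Subgroup T.Isom) : Setoid T.verts where
  r v w := ∃ γ ∈ Γ, (γ : X ≃ᵢ X) (v : X) = w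
  iseqv :=
    { refl := fun _ => ⟨1, Γ.one_mem, rfl⟩
      symm := by
        rintro v w ⟨γ, hγ, h⟩
        refine ⟨γ⁻¹, Γ.inv_mem hγ, ?_⟩
        rw [← h, InvMemClass.coe_inv, IsometryEquiv.inv_apply_self]
      trans := by
        rintro u v w ⟨γ, hγ, h⟩ ⟨δ, hδ, h'⟩
        refine ⟨δ * γ, Γ.mul_mem hδ hγ, ?_⟩
        rw [Subgroup.coe_mul, IsometryEquiv.mul_apply, h, h'] }

/-- Two oriented edges are equivalent if they lie in the same orbit of `Γ`. -/
def edgeSetoid (T : SimplicialRealTree X) (Γ : Subgroup T.Isom) : Setoid T.graph.Dart where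
  r d e := ∃ γ ∈ Γ, (γ : X ≃ᵢ X) (d.fst : X) = e.fst ∧ (γ : X ≃ᵢ X) (d.snd : X) = e.snd
  iseqv :=
    { refl := fun _ => ⟨1, Γ.one_mem, rfl, rfl⟩
      symm := by
        rintro d e ⟨γ, hγ, h₁, h₂⟩
        refine ⟨γ⁻¹, Γ.inv_mem hγ, ?_, ?_⟩
        · rw [← h₁, InvMemClass.coe_inv, IsometryEquiv.inv_apply_self]
        · rw [← h₂, InvMemClass.coe_inv, IsometryEquiv.inv_apply_self]
      trans := by
        rintro c d e ⟨γ, hγ, h₁, h₂⟩ ⟨δ, hδ, h₁', h₂'⟩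
        refine ⟨δ * γ, Γ.mul_mem hδ hγ, ?_, ?_⟩
        · rw [Subgroup.coe_mul, IsometryEquiv.mul_apply, h₁, h₁']
        · rw [Subgroup.coe_mul, IsometryEquiv.mul_apply, h₂, h₂'] }

/-- The vertices of the quotient graph `Γ\X`. -/
def QuotientVerts (T : SimplicialRealTree X) (Γ : Subgroup T.Isom) : Type _ :=
  Quotient (T.vertexSetoid Γ)

/-- The oriented edges of the quotient graph `Γ\X`. -/
def QuotientEdges (T : SimplicialRealTree X) (Γ : Subgroup T.Isom) : Type _ :=
  Quotient (T.edgeSetoid Γ)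

/-- The translation length `λ(g) = inf_{x ∈ X} d(x, g x)`. -/
noncomputable def translationLength {T : SimplicialRealTree X} (g : T.Isom) : ℝ :=
  ⨅ x : X, dist x ((g : X ≃ᵢ X) x)

/-- `f` is piecewise affine: on every edge it multiplies distances by a constant. -/
def PiecewiseAffine (T : SimplicialRealTree X) (f : X → X') : Prop :=
  ∀ v w : T.verts, T.graph.Adj v w → ∃ c : ℝ, 0 ≤ c ∧
    ∀ x₁ ∈ metricSegment (v : X) (w : X), ∀ x₂ ∈ metricSegment (v : X) (w : X),
      dist (f x₁) (f x₂) = c * dist x₁ x₂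

/-- `f` is `ρ`-equivariant: `f (γ x) = ρ(γ) f(x)`. -/
def Equivariant {T : SimplicialRealTree X} {T' : SimplicialRealTree X'} {Γ : Subgroup T.Isom}
    (ρ : Γ →* T'.Isom) (f : X → X') : Prop :=
  ∀ (γ : Γ) (x : X), f (((γ : T.Isom) : X ≃ᵢ X) x) = (ρ γ : X' ≃ᵢ X') (f x)

/-- The set of nontrivial `γ ∈ Γ` with `d(x₀, γ x₀) ≤ R`. -/
def smallDisplacement {T : SimplicialRealTree X} (Γ : Subgroup T.Isom) (x₀ : X) (R : ℝ) :
    Set Γ :=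
  {γ | γ ≠ 1 ∧ dist x₀ (((γ : T.Isom) : X ≃ᵢ X) x₀) ≤ R}

end SimplicialRealTree

/-!
The target `X'` matters only through two metric facts: it is geodesic and satisfies the four-point
condition (`SimplicialRealTree.isRealTree`, proved by growing subtrees one edge at a time). Write
`C` for the supremum of the ratios `λ(ρ(γ)) / λ(γ)`. An equivariant `K`-Lipschitz map gives
`λ(ρ(γ)) ≤ K λ(γ)`, so no equivariant map has a Lipschitz constant less than `C`.

A map with Lipschitz constant `C` is constructed directly, without compactness, which would fail
when `X'` is not locally finite. Since `Γ₀` acts freely on `X`, an equivariant piecewise affine map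
amounts to a choice of images for representatives of the finitely many vertex orbits, subject to
finitely many conditions `d(y_i, ρ(g) y_j) ≤ C d(x_i, g x_j)`. These are solved by eliminating one
orbit after the other (`IsRealTree.exists_equivariant_contraction`): each condition on the point to
be placed confines it to a convex set, either a ball or a sublevel set of the displacement of an
isometry, and by Helly's theorem only pairwise intersections have to be checked. Intersections
involving a ball translate into conditions of the same kind on the remaining orbits. Two sublevel
sets meet because `λ(ρ(γ)) ≤ C λ(γ)` holds for the product of the two isometries
(`IsRealTree.exists_common_displacement_le`); that each sublevel set is nonempty uses that
isometries of real trees are semisimple (`IsRealTree.exists_min_displacement`).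

To see that the ratio `C` is attained by a short element when `C > 0`, take among the
`C`-Lipschitz maps one with the fewest orbits of tight edges, those stretched by `C` exactly. If all
tight edges at some vertex left in the same direction of `X'`, moving the image of the vertex in
that direction would lose tight edges (`exists_less_tight`). Hence at each vertex of the tight
subgraph two tight edges leave in different directions. Fixing two such edges at every vertex, one
follows them without ever folding; this walk has `2N` states modulo `Γ₀`, so it closes up after at
most `2N` edges, and its period `γ` translates a geodesic of `X'` by `C` times the length of the
walk (`exists_tight_axis`). Vertices of the quotient are joined by at most `N - 1` edges, which
gives a conjugate of `γ` displacing `x₀` by at most `4NL`. For `C = 0` the same walk for the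
identity map of `X` provides a nontrivial element of small displacement, and every ratio is `0`.
-/

/-! ### Real trees via the four-point condition -/

/-- A real tree, described metrically: a geodesic space satisfying the four-point condition.
Geodesics are only asked to exist pointwise, which is all that is ever used. -/
structure IsRealTree (Y : Type*) [MetricSpace Y] : Prop where
  exists_between : ∀ (x y : Y) (t : ℝ), 0 ≤ t → t ≤ dist x y →
    ∃ z, dist x z = t ∧ dist z y = dist x y - t
  fourPoint : ∀ a b c d : Y,
    dist a b + dist c d ≤ max (dist a c + dist b d) (dist a d + dist b c)

namespace IsRealTree

variable {Y : Type*} [MetricSpace Y]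


theorem fourPoint_or (hY : IsRealTree Y) (a b c d : Y) :
    dist a b + dist c d ≤ dist a c + dist b d ∨ dist a b + dist c d ≤ dist a d + dist b c :=
  le_max_iff.1 (hY.fourPoint a b c d)


/-- Geodesics in a real tree extend locally to globally: if `[a, c]` passes through `b`, `[b, d]`
passes through `c` and the overlap `[b, c]` is nondegenerate, then `[a, d]` passes through `c`. -/
theorem dist_add_of_overlap (hY : IsRealTree Y) {a b c d : Y} (hbc : b ≠ c)
    (h₁ : dist a c = dist a b + dist b c) (h₂ : dist b d = dist b c + dist c d) :
    dist a d = dist a c + dist c d := by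
  have hpos := dist_pos.2 hbc
  have := dist_triangle a c d
  rcases hY.fourPoint_or a c b d with h | h <;> linarith [dist_comm c b, dist_comm c d]

/-- A sequence all of whose turns are geodesic is geodesic. -/
theorem dist_eq_sum (hY : IsRealTree Y) (p : ℕ → Y) (hne : ∀ k, p k ≠ p (k + 1))
    (hp : ∀ k, dist (p k) (p (k + 2)) = dist (p k) (p (k + 1)) + dist (p (k + 1)) (p (k + 2)))
    (n : ℕ) : dist (p 0) (p n) = ∑ k ∈ Finset.range n, dist (p k) (p (k + 1)) := by
  have key : ∀ n, dist (p 0) (p (n + 1)) = dist (p 0) (p n) + dist (p n) (p (n + 1)) := by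
    intro n
    induction n with
    | zero => simp
    | succ n ih => exact hY.dist_add_of_overlap (hne n) ih (hp n)
  induction n with
  | zero => simp
  | succ n ih => rw [Finset.sum_range_succ, key, ih]

/-- Points of a common segment are as far apart as their distances to one end differ. -/
theorem dist_le_of_mem_segment (hY : IsRealTree Y) {x y z z' : Y}
    (hz : dist x z + dist z y = dist x y) (hz' : dist x z' + dist z' y = dist x y) :
    dist z z' ≤ |dist x z - dist x z'| := by
  have h1 := le_abs_self (dist x z - dist x z')
  have h2 := neg_abs_le (dist x z - dist x z')
  rcases hY.fourPoint_or z z' x y with h | h <;>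
    linarith [dist_comm x z, dist_comm x z', dist_comm z y, dist_comm z' y]

theorem dist_eq_abs_of_mem_segment (hY : IsRealTree Y) {x y z z' : Y}
    (hz : dist x z + dist z y = dist x y) (hz' : dist x z' + dist z' y = dist x y) :
    dist z z' = |dist x z - dist x z'| := by
  refine le_antisymm (hY.dist_le_of_mem_segment hz hz') (abs_sub_le_iff.2 ⟨?_, ?_⟩)
  · linarith [dist_triangle x z' z, dist_comm z z']
  · linarith [dist_triangle x z z']

theorem eq_of_mem_segment (hY : IsRealTree Y) {x y z z' : Y}
    (hz : dist x z + dist z y = dist x y) (hz' : dist x z' + dist z' y = dist x y)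
    (h : dist x z = dist x z') : z = z' := by
  have := hY.dist_le_of_mem_segment hz hz'
  rw [h, sub_self, abs_zero] at this
  exact dist_le_zero.1 this

/-- Three points of a real tree have a median. -/
theorem exists_median (hY : IsRealTree Y) (a b c : Y) :
    ∃ m, dist a m + dist m b = dist a b ∧ dist a m + dist m c = dist a c ∧
      dist b m + dist m c = dist b c := by
  obtain ⟨m, h1, h2⟩ := hY.exists_between a b ((dist a b + dist a c - dist b c) / 2)
    (by linarith [dist_triangle_left b c a]) (by linarith [dist_triangle a b c])
  have hm : dist m c ≤ (dist a c + dist b c - dist a b) / 2 := by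
    rcases hY.fourPoint_or m c a b with h | h <;>
      linarith [dist_comm m a, dist_comm c a, dist_comm c b]
  refine ⟨m, by linarith, ?_, ?_⟩
  · linarith [dist_triangle a m c]
  · linarith [dist_triangle b m c, dist_comm b m]

/-! ### Isometries of a real tree -/

/-- The displacement of one point bounds the translation length from below: for an isometry `g`
the quantity `d(p, g² p) - d(p, g p)` is at most the displacement of any other point. -/
theorem dist_sq_le (hY : IsRealTree Y) (g : Y ≃ᵢ Y) (p q : Y) :
    dist p (g (g p)) ≤ dist p (g p) + dist q (g q) := by
  have h1 := g.dist_eq p q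
  have h2 := g.dist_eq (g p) q
  have h3 := g.dist_eq p (g p)
  have h4 := dist_triangle (g p) (g q) q
  have h5 := dist_triangle p q (g q)
  rcases hY.fourPoint_or p (g (g p)) (g p) (g q) with h | h <;>
    linarith [dist_comm (g q) q, dist_comm (g (g p)) (g p)]

/-- Isometries of a real tree are semisimple: the infimum of the displacement is attained. -/
theorem exists_min_displacement (hY : IsRealTree Y) [Nonempty Y] (g : Y ≃ᵢ Y) :
    ∃ q, ∀ p, dist q (g q) ≤ dist p (g p) := by
  obtain ⟨p⟩ := ‹Nonempty Y›
  have h0 := g.dist_eq p (g p)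
  have htri := dist_triangle p (g p) (g (g p))
  set D := dist p (g p) with hD
  set E := dist p (g (g p)) with hE
  -- `τ` is the Gromov product `(g⁻¹ p | g p)_p`, cut off at the midpoint of `[p, g p]`
  set τ := min (D / 2) (D - E / 2) with hτ
  have hτ1 : τ ≤ D / 2 := min_le_left _ _
  have hτ2 : τ ≤ D - E / 2 := min_le_right _ _
  have hD0 : 0 ≤ D := dist_nonneg
  have hτ0 : 0 ≤ τ := le_min (by linarith) (by linarith)
  obtain ⟨z, hz1, hz2⟩ := hY.exists_between p (g p) τ hτ0 (by linarith)
  have hg1 := g.dist_eq p z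
  have hg2 := g.dist_eq z (g p)
  have hpz : dist p (g z) ≤ D - τ := by
    rcases hY.fourPoint_or p (g z) (g p) (g (g p)) with h | h <;>
      linarith [dist_comm (g z) (g p)]
  have hzz : dist z (g z) ≤ D - 2 * τ := by
    rcases hY.fourPoint_or z (g z) p (g p) with h | h <;>
      linarith [dist_comm z p, dist_comm (g z) (g p), dist_comm (g z) p]
  refine ⟨z, fun q => hzz.trans ?_⟩
  rcases min_choice (D / 2) (D - E / 2) with h | h
  · linarith [dist_nonneg (x := q) (y := g q)]
  · linarith [hY.dist_sq_le g p q]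

/-- From a point `p` displaced by at most `s + 2r`, moving by at most `r` towards a point displaced
by at most `s` suffices to make the displacement at most `s`. -/
theorem exists_displacement_le (hY : IsRealTree Y) (h : Y ≃ᵢ Y) {p q : Y} {r s : ℝ} (hr : 0 ≤ r)
    (hp : dist p (h p) ≤ s + 2 * r) (hq : dist q (h q) ≤ s) :
    ∃ z, dist p z + dist z q = dist p q ∧ dist p z ≤ r ∧ dist z (h z) ≤ s := by
  rcases le_total (dist p q) r with hpq | hpq
  · exact ⟨q, by simp, hpq, hq⟩
  obtain ⟨z, hz1, hz2⟩ := hY.exists_between p q r hr hpq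
  refine ⟨z, by linarith, hz1.le, ?_⟩
  by_contra! hlt
  have hs : 0 ≤ s := dist_nonneg.trans hq
  have e1 := h.dist_eq p z
  have e2 := h.dist_eq z q
  have e3 := h.dist_eq p q
  have f1 : dist z (h z) + r ≤ dist (h z) p := by
    have := dist_triangle (h z) (h q) q
    rcases hY.fourPoint_or z (h z) p q with h' | h' <;>
      linarith [dist_comm z p, dist_comm (h q) q]
  have f2 : dist z (h z) + r ≤ dist z (h p) := by
    have := dist_triangle z q (h q)
    rcases hY.fourPoint_or (h z) z (h p) (h q) with h' | h' <;>
      linarith [dist_comm (h z) (h p), dist_comm (h z) z]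
  rcases hY.fourPoint_or p (h z) z (h p) with h' | h' <;>
    linarith [dist_comm (h z) p, dist_comm (h z) (h p), dist_comm (h z) z]

/-- If the composition `h' h` displaces some point by at most `s + s'`, then the sublevel set `s`
of the displacement of `h` meets the sublevel set `s'` of the displacement of `h'`, provided both
are nonempty. Otherwise a bridge of length `2r > 0` between them would force the translation
length of `h' h` to be `s + s' + 4r`. -/
theorem exists_common_displacement_le (hY : IsRealTree Y) (h h' : Y ≃ᵢ Y) {q q' w : Y} {s s' : ℝ}
    (hq : dist q (h q) ≤ s) (hq' : dist q' (h' q') ≤ s')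
    (hw : dist w (h' (h w)) ≤ s + s') :
    ∃ z, dist z (h z) ≤ s ∧ dist z (h' z) ≤ s' := by
  rcases le_or_gt (dist q' (h q')) s with hs | hs
  · exact ⟨q', hs, hq'⟩
  obtain ⟨z, hz1, hz2, hz3⟩ := hY.exists_displacement_le h (p := q') (q := q)
    (r := (dist q' (h q') - s) / 2) (by linarith) (by linarith) hq
  rcases le_or_gt (dist z (h' z)) s' with hs' | hs'
  · exact ⟨z, hz3, hs'⟩
  obtain ⟨z', hy1, hy2, hy3⟩ := hY.exists_displacement_le h' (p := z) (q := q')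
    (r := (dist z (h' z) - s') / 2) (by linarith) (by linarith) hq'
  exfalso
  -- `[z, z']` is a bridge between the two sublevel sets
  set r := dist z z' / 2 with hr
  have a1 : s' + 4 * r ≤ dist z (h' z) := by linarith
  have a2 : s + 4 * r ≤ dist z' (h z') := by
    have := dist_triangle4 q' z' (h z') (h q')
    have := h.dist_eq z' q'
    linarith [dist_comm z q', dist_comm z' q']
  have hrpos : 0 < r := by
    have := dist_triangle4 z z' (h' z') (h' z)
    have := h'.dist_eq z' z
    linarith [dist_comm z z']
  obtain ⟨c, hc1, hc2⟩ := hY.exists_between z z' r hrpos.le (by linarith)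
  have hc3 : dist c z' = r := by linarith
  have hzc : z ≠ c := dist_pos.1 (by linarith)
  have hcz' : c ≠ z' := dist_pos.1 (by linarith)
  have b1 : s + 2 * r ≤ dist c (h c) := by
    have := dist_triangle4 z' c (h c) (h z')
    have := h.dist_eq c z'
    linarith [dist_comm c z']
  have b2 : s' + 2 * r ≤ dist c (h' c) := by
    have := dist_triangle4 z c (h' c) (h' z)
    have := h'.dist_eq c z
    linarith [dist_comm c z]
  -- seen from `c`, points at `z`'s side and points at `z'`'s side lie in opposite directions
  have turn : ∀ A B : Y, dist A z ≤ dist A c - r → dist B z' ≤ dist B c - r →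
      dist A B = dist A c + dist c B := by
    intro A B hA hB
    have hA' : dist A c = dist A z + dist z c := by linarith [dist_triangle A z c]
    have hB' : dist c B = dist c z' + dist z' B := by
      linarith [dist_triangle c z' B, dist_comm B z', dist_comm B c]
    have := hY.dist_add_of_overlap hzc hA' (show dist z z' = dist z c + dist c z' by linarith)
    have := hY.dist_add_of_overlap hcz' this hB'
    linarith
  have s0 : 0 ≤ s := dist_nonneg.trans hq
  have s0' : 0 ≤ s' := dist_nonneg.trans hq'
  have k1 : dist (h c) z ≤ dist (h c) c - r := by
    have := dist_triangle (h c) (h z) z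
    have := h.dist_eq c z
    linarith [dist_comm (h z) z, dist_comm (h c) c, dist_comm c z]
  have k2 : dist (h.symm c) z ≤ dist (h.symm c) c - r := by
    have e1 := h.dist_eq (h.symm c) z
    have e2 := h.dist_eq (h.symm c) c
    rw [h.apply_symm_apply] at e1 e2
    have := dist_triangle c z (h z)
    linarith [dist_comm c z]
  have k3 : dist (h' c) z' ≤ dist (h' c) c - r := by
    have := dist_triangle (h' c) (h' z') z'
    have := h'.dist_eq c z'
    linarith [dist_comm (h' z') z', dist_comm (h' c) c, dist_comm c z']
  have k4 : dist (h'.symm c) z' ≤ dist (h'.symm c) c - r := by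
    have e1 := h'.dist_eq (h'.symm c) z'
    have e2 := h'.dist_eq (h'.symm c) c
    rw [h'.apply_symm_apply] at e1 e2
    have := dist_triangle c z' (h' z')
    linarith [dist_comm c z']
  have t1 : dist c (h' (h c)) = dist c (h' c) + dist (h' c) (h' (h c)) := by
    have := turn _ _ k1 k4
    have e1 := h'.dist_eq (h.trans h' c) (h' c)
    have e2 := h'.dist_eq (h c) (h'.symm c)
    have e3 := h'.dist_eq c (h'.symm c)
    have e4 := h'.dist_eq (h c) c
    rw [h'.apply_symm_apply] at e2 e3
    linarith [dist_comm c (h' (h c)), dist_comm c (h' c), dist_comm (h' c) (h' (h c))]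
  have t2 : dist (h' c) (h' (h (h' c))) =
      dist (h' c) (h' (h c)) + dist (h' (h c)) (h' (h (h' c))) := by
    have := turn _ _ k2 k3
    simp only [h'.dist_eq]
    have e1 := h.dist_eq (h.symm c) (h' c)
    have e2 := h.dist_eq (h.symm c) c
    have e3 := h.dist_eq c (h' c)
    rw [h.apply_symm_apply] at e1 e2
    linarith [h.dist_eq c (h' c)]
  have n1 : h' c ≠ h' (h c) := h'.injective.ne (dist_pos.1 (by linarith))
  have n2 : h' (h c) ≠ h' (h (h' c)) :=
    h'.injective.ne (h.injective.ne (dist_pos.1 (by linarith)))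
  have t3 : dist (h' (h c)) (h' (h (h' (h c)))) =
      dist (h' (h c)) (h' (h (h' c))) + dist (h' (h (h' c))) (h' (h (h' (h c)))) := by
    simpa only [h.dist_eq, h'.dist_eq] using t1
  have u1 := hY.dist_add_of_overlap n1 t1 t2
  have u2 := hY.dist_add_of_overlap n2 u1 t3
  have u3 := hY.dist_sq_le (h.trans h') c w
  simp only [IsometryEquiv.trans_apply] at u3
  simp only [h.dist_eq, h'.dist_eq] at u1 u2 t1 t2 t3
  linarith

/-! ### Helly's theorem for convex subsets of a real tree -/

/-- Convexity in a real tree. -/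
def IsSegmentConvex (S : Set Y) : Prop :=
  ∀ x ∈ S, ∀ y ∈ S, metricSegment x y ⊆ S

theorem isSegmentConvex_closedBall (hY : IsRealTree Y) (p : Y) (r : ℝ) :
    IsSegmentConvex {z | dist z p ≤ r} := by
  intro x hx y hy z hz
  simp only [metricSegment, Set.mem_ofPred_eq] at *
  rcases hY.fourPoint_or z p x y with h | h <;>
    linarith [dist_comm z x, dist_comm p x, dist_comm p y, dist_nonneg (x := x) (y := z),
      dist_nonneg (x := z) (y := y)]

theorem isSegmentConvex_displacement (hY : IsRealTree Y) (h : Y ≃ᵢ Y) (s : ℝ) :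
    IsSegmentConvex {z | dist z (h z) ≤ s} := by
  intro x hx y hy z hz
  simp only [metricSegment, Set.mem_ofPred_eq] at *
  have e1 := h.dist_eq z y
  have e2 := h.dist_eq z x
  have := dist_triangle (h z) (h y) y
  have := dist_triangle (h z) (h x) x
  rcases hY.fourPoint_or z (h z) x y with h' | h' <;>
    linarith [dist_comm z x, dist_comm (h y) y, dist_comm (h x) x]

theorem IsSegmentConvex.inter {S S' : Set Y} (hS : IsSegmentConvex S) (hS' : IsSegmentConvex S') :
    IsSegmentConvex (S ∩ S') := fun x hx y hy _ hz =>
  ⟨hS x hx.1 y hy.1 hz, hS' x hx.2 y hy.2 hz⟩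

theorem inter_inter_nonempty (hY : IsRealTree Y) {A B D : Set Y} (hA : IsSegmentConvex A)
    (hB : IsSegmentConvex B) (hD : IsSegmentConvex D) (hAB : (A ∩ B).Nonempty)
    (hAD : (A ∩ D).Nonempty) (hBD : (B ∩ D).Nonempty) : ((A ∩ D) ∩ (B ∩ D)).Nonempty := by
  obtain ⟨x, hxA, hxB⟩ := hAB
  obtain ⟨y, hyA, hyD⟩ := hAD
  obtain ⟨z, hzB, hzD⟩ := hBD
  obtain ⟨m, h1, h2, h3⟩ := hY.exists_median x y z
  have hmD := hD y hyD z hzD h3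
  exact ⟨m, ⟨hA x hxA y hyA h1, hmD⟩, hB x hxB z hzB h2, hmD⟩

/-- Helly's theorem: finitely many pairwise intersecting convex subsets of a real tree have a
common point. -/
theorem helly (hY : IsRealTree Y) [Nonempty Y] {ι : Type*} (s : Finset ι) (S : ι → Set Y)
    (hconv : ∀ i ∈ s, IsSegmentConvex (S i))
    (hmeet : ∀ i ∈ s, ∀ j ∈ s, (S i ∩ S j).Nonempty) : ∃ z, ∀ i ∈ s, z ∈ S i := by
  classical
  induction s using Finset.induction_on generalizing S with
  | empty => exact ⟨Classical.arbitrary Y, by simp⟩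
  | insert a s ha ih =>
    rcases s.eq_empty_or_nonempty with rfl | ⟨b, hb⟩
    · obtain ⟨z, hz, -⟩ := hmeet a (by simp) a (by simp)
      exact ⟨z, by simpa using hz⟩
    obtain ⟨z, hz⟩ := ih (fun i => S i ∩ S a)
      (fun i hi => (hconv i (by simp [hi])).inter (hconv a (by simp)))
      (fun i hi j hj => hY.inter_inter_nonempty (hconv i (by simp [hi])) (hconv j (by simp [hj]))
        (hconv a (by simp)) (hmeet i (by simp [hi]) j (by simp [hj]))
        (hmeet i (by simp [hi]) a (by simp)) (hmeet j (by simp [hj]) a (by simp)))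
    refine ⟨z, fun i hi => ?_⟩
    rcases Finset.mem_insert.1 hi with rfl | hi
    · exact (hz b hb).2
    · exact (hz i hi).1

/-! ### Equivariant maps with prescribed Lipschitz constant -/

open scoped Pointwise in
/-- Existence of equivariant maps by elimination of orbits. Suppose every `γ` has a point of `Y`
displaced at most `C` times as far as any point of `X`. Then orbits of finitely many points of `X`
can be mapped equivariantly to `Y` so that finitely many prescribed distances are multiplied by at
most `C`. To place one more orbit one has to find a common point of finitely many balls and
sublevel sets of displacements; these intersect pairwise if the map on the earlier orbits satisfies
the conditions for a larger finite set `K' ⊆ Γ`. -/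
theorem exists_equivariant_contraction (hY : IsRealTree Y) {X Γ ι : Type*} [MetricSpace X]
    [Group Γ] (φ : Γ →* (X ≃ᵢ X)) (ψ : Γ →* (Y ≃ᵢ Y)) {C : ℝ} (hC : 0 ≤ C)
    (hdisp : ∀ γ x, ∃ q, dist q (ψ γ q) ≤ C * dist x (φ γ x)) [Nonempty Y]
    (x : ι → X) (s : Finset ι) (K : Set Γ) (hK : K.Finite) :
    ∃ y : ι → Y, ∀ i ∈ s, ∀ j ∈ s, ∀ g ∈ K,
      dist (y i) (ψ g (y j)) ≤ C * dist (x i) (φ g (x j)) := by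
  classical
  induction s using Finset.induction_on generalizing K with
  | empty => exact ⟨fun _ => Classical.arbitrary Y, by simp⟩
  | insert k s hk ih =>
    set K₁ : Set Γ := K ∪ K⁻¹ ∪ {1} with hK₁
    have hK₁fin : K₁.Finite := (hK.union hK.inv).union (Set.finite_singleton _)
    have hinv : ∀ g ∈ K₁, g⁻¹ ∈ K₁ := by
      rintro g ((hg | hg) | hg)
      · exact Or.inl (Or.inr (by simpa using hg))
      · exact Or.inl (Or.inl hg)
      · exact Or.inr (by simpa using hg)
    obtain ⟨y, hy⟩ := ih (K₁ * K₁ * K₁) ((hK₁fin.mul hK₁fin).mul hK₁fin)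
    have hone : (1 : Γ) ∈ K₁ := Or.inr rfl
    have hsub : K ⊆ K₁ * K₁ * K₁ := fun g hg =>
      ⟨g * 1, ⟨g, Or.inl (Or.inl hg), 1, hone, rfl⟩, 1, hone, by simp⟩
    -- the conditions on the image of the new orbit: balls around the old points and sublevel sets
    let S : (ι × Γ) ⊕ Γ → Set Y := Sum.elim
      (fun a => {z | dist z (ψ a.2 (y a.1)) ≤ C * dist (x k) (φ a.2 (x a.1))})
      (fun h => {z | dist z (ψ h z) ≤ C * dist (x k) (φ h (x k))})
    let t : Finset ((ι × Γ) ⊕ Γ) := (s ×ˢ hK₁fin.toFinset).disjSum hK₁fin.toFinset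
    have ball_loop : ∀ i ∈ s, ∀ g ∈ K₁, ∀ h ∈ K₁, ∃ z,
        dist z (ψ g (y i)) ≤ C * dist (x k) (φ g (x i)) ∧
        dist z (ψ h z) ≤ C * dist (x k) (φ h (x k)) := by
      intro i hi g hg h hh
      obtain ⟨q, hq⟩ := hdisp h (x k)
      have h1 := hy i hi i hi (g⁻¹ * h * g) ⟨g⁻¹ * h, ⟨g⁻¹, hinv g hg, h, hh, rfl⟩, g, hg, rfl⟩
      have h2 := (ψ g).dist_eq (y i) (ψ (g⁻¹ * h * g) (y i))
      have h3 := (φ g).dist_eq (x i) (φ (g⁻¹ * h * g) (x i))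
      simp only [← IsometryEquiv.mul_apply, ← map_mul] at h2 h3
      simp only [mul_assoc, mul_inv_cancel_left] at h1 h2 h3
      simp only [map_mul, IsometryEquiv.mul_apply] at h2 h3
      have h4 := dist_triangle4 (φ g (x i)) (x k) (φ h (x k)) (φ h (φ g (x i)))
      have h5 := (φ h).dist_eq (x k) (φ g (x i))
      obtain ⟨z, -, hz2, hz3⟩ := hY.exists_displacement_le (ψ h) (p := ψ g (y i)) (q := q)
        (r := C * dist (x k) (φ g (x i))) (s := C * dist (x k) (φ h (x k))) (by positivity)
        (by
          rw [h2]
          simp only [map_mul, IsometryEquiv.mul_apply] at h1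
          refine h1.trans ?_
          rw [← h3]
          calc _ ≤ C * _ := mul_le_mul_of_nonneg_left h4 hC
            _ = _ := by rw [h5, dist_comm (φ g (x i)) (x k)]; ring) hq
      exact ⟨z, by rwa [dist_comm], hz3⟩
    obtain ⟨z, hz⟩ := hY.helly t S
      (by
        rintro (⟨i, g⟩ | h) -
        · exact hY.isSegmentConvex_closedBall _ _
        · exact hY.isSegmentConvex_displacement _ _)
      (by
        rintro (⟨i, g⟩ | h) h1 (⟨j, g'⟩ | h') h2 <;>
          simp only [t, Finset.inl_mem_disjSum, Finset.inr_mem_disjSum, Finset.mem_product,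
            Set.Finite.mem_toFinset] at h1 h2
        · have e1 := hy i h1.1 j h2.1 (g⁻¹ * g')
            ⟨g⁻¹ * g', ⟨g⁻¹, hinv g h1.2, g', h2.2, rfl⟩, 1, hone, by simp⟩
          have e2 := (ψ g).dist_eq (y i) (ψ (g⁻¹ * g') (y j))
          have e3 := (φ g).dist_eq (x i) (φ (g⁻¹ * g') (x j))
          simp only [← IsometryEquiv.mul_apply, ← map_mul, mul_inv_cancel_left] at e2 e3
          have e4 := dist_triangle_left (φ g (x i)) (φ g' (x j)) (x k)
          rw [← e2, ← e3] at e1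
          have e5 : dist (ψ g (y i)) (ψ g' (y j)) ≤
              C * dist (x k) (φ g (x i)) + C * dist (x k) (φ g' (x j)) := by
            rw [← mul_add]
            exact e1.trans (mul_le_mul_of_nonneg_left e4 hC)
          have p1 : 0 ≤ C * dist (x k) (φ g (x i)) := by positivity
          have p2 : 0 ≤ C * dist (x k) (φ g' (x j)) := by positivity
          obtain ⟨z, hz1, hz2⟩ := hY.exists_between (ψ g (y i)) (ψ g' (y j))
            (min (C * dist (x k) (φ g (x i))) (dist (ψ g (y i)) (ψ g' (y j))))
            (le_min p1 dist_nonneg) (min_le_right _ _)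
          refine ⟨z, ?_, ?_⟩
          · change dist z _ ≤ _
            rw [dist_comm, hz1]
            exact min_le_left _ _
          · change dist z _ ≤ _
            rw [hz2]
            rcases min_choice (C * dist (x k) (φ g (x i)))
              (dist (ψ g (y i)) (ψ g' (y j))) with h | h <;> rw [h] <;> linarith
        · obtain ⟨z, hz1, hz2⟩ := ball_loop i h1.1 g h1.2 h' h2
          exact ⟨z, hz1, hz2⟩
        · obtain ⟨z, hz1, hz2⟩ := ball_loop j h2.1 g' h2.2 h h1
          exact ⟨z, hz2, hz1⟩
        · obtain ⟨q, hq⟩ := hdisp h (x k)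
          obtain ⟨q', hq'⟩ := hdisp h' (x k)
          obtain ⟨w, hw⟩ := hdisp (h' * h) (x k)
          have e1 := dist_triangle (x k) (φ h' (x k)) (φ h' (φ h (x k)))
          rw [(φ h').dist_eq] at e1
          rw [map_mul, map_mul, IsometryEquiv.mul_apply, IsometryEquiv.mul_apply] at hw
          obtain ⟨z, hz1, hz2⟩ := hY.exists_common_displacement_le (ψ h) (ψ h') hq hq'
            (hw.trans (by
              rw [← mul_add]
              exact mul_le_mul_of_nonneg_left (by linarith) hC))
          exact ⟨z, hz1, hz2⟩)
    have hzb : ∀ i ∈ s, ∀ g ∈ K₁, dist z (ψ g (y i)) ≤ C * dist (x k) (φ g (x i)) :=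
      fun i hi g hg => hz (Sum.inl (i, g)) (by simp [t, hi, hg])
    have hzl : ∀ g ∈ K₁, dist z (ψ g z) ≤ C * dist (x k) (φ g (x k)) :=
      fun g hg => hz (Sum.inr g) (by simp [t, hg])
    have hKK₁ : K ⊆ K₁ := fun g hg => Or.inl (Or.inl hg)
    refine ⟨Function.update y k z, fun i hi j hj g hg => ?_⟩
    rcases Finset.mem_insert.1 hi with rfl | hi' <;> rcases Finset.mem_insert.1 hj with rfl | hj'
    · simpa using hzl g (hKK₁ hg)
    · rw [Function.update_self, Function.update_of_ne (by rintro rfl; exact hk hj')]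
      exact hzb j hj' g (hKK₁ hg)
    · rw [Function.update_self, Function.update_of_ne (by rintro rfl; exact hk hi')]
      have h1 := hzb i hi' g⁻¹ (hinv g (hKK₁ hg))
      have h2 := (ψ g).dist_eq z (ψ g⁻¹ (y i))
      have h3 := (φ g).dist_eq (x j) (φ g⁻¹ (x i))
      simp only [← IsometryEquiv.mul_apply, ← map_mul, mul_inv_cancel] at h2 h3
      simp only [map_one, IsometryEquiv.coe_one, id] at h2 h3
      rwa [dist_comm, h2, dist_comm (x i), h3]
    · rw [Function.update_of_ne (by rintro rfl; exact hk hi'),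
        Function.update_of_ne (by rintro rfl; exact hk hj')]
      exact hy i hi' j hj' g (hsub hg)

end IsRealTree

/-! ### Simplicial real trees are real trees -/

namespace SimplicialRealTree

variable {X : Type*} [MetricSpace X]

theorem left_mem_metricSegment (x y : X) : x ∈ metricSegment x y := by simp [metricSegment]

theorem right_mem_metricSegment (x y : X) : y ∈ metricSegment x y := by simp [metricSegment]

theorem metricSegment_comm (x y : X) : metricSegment x y = metricSegment y x := by
  ext z
  simp only [metricSegment, Set.mem_ofPred_eq]
  rw [dist_comm x z, dist_comm z y, dist_comm x y, add_comm]

/-- An edge parametrized by the distance to one of its ends. -/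
theorem exists_edge_coord (T : SimplicialRealTree X) {v w : T.verts} (h : T.graph.Adj v w) :
    (∀ x ∈ metricSegment (v : X) (w : X), ∀ y ∈ metricSegment (v : X) (w : X),
      dist x y = |dist (v : X) x - dist (v : X) y|) ∧
    ∀ t, 0 ≤ t → t ≤ dist (v : X) (w : X) → ∃ z ∈ metricSegment (v : X) (w : X),
      dist (v : X) z = t := by
  obtain ⟨e⟩ := T.edge_isometric v w h
  have hd : ∀ x y : metricSegment (v : X) (w : X),
      dist (x : X) y = |(e.symm x : ℝ) - e.symm y| := fun x y => by
    rw [← Subtype.dist_eq, ← e.symm.dist_eq, Subtype.dist_eq, Real.dist_eq]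
  have hb := fun x : metricSegment (v : X) (w : X) => (e.symm x).2
  set v' : metricSegment (v : X) (w : X) := ⟨v, left_mem_metricSegment _ _⟩
  set w' : metricSegment (v : X) (w : X) := ⟨w, right_mem_metricSegment _ _⟩
  have hvw : dist (v : X) w = |(e.symm v' : ℝ) - e.symm w'| := hd v' w'
  obtain ⟨hv1, hv2⟩ := hb v'
  obtain ⟨hw1, hw2⟩ := hb w'
  -- the parametrization starts at one of the two ends of the interval
  have hend : (e.symm v' : ℝ) = 0 ∨ (e.symm v' : ℝ) = dist (v : X) w := by
    rcases abs_cases ((e.symm v' : ℝ) - e.symm w') with h | h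
    · right; linarith
    · left; linarith
  constructor
  · intro x hx y hy
    obtain ⟨hx1, hx2⟩ := hb ⟨x, hx⟩
    obtain ⟨hy1, hy2⟩ := hb ⟨y, hy⟩
    have e1 := hd v' ⟨x, hx⟩
    have e2 := hd v' ⟨y, hy⟩
    have e3 := hd ⟨x, hx⟩ ⟨y, hy⟩
    change dist (v : X) x = _ at e1
    change dist (v : X) y = _ at e2
    change dist x y = _ at e3
    rw [e1, e2, e3]
    rcases hend with h | h <;> rw [h]
    · rw [zero_sub, zero_sub, abs_neg, abs_neg, abs_of_nonneg hx1, abs_of_nonneg hy1]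
    · rw [abs_of_nonneg (sub_nonneg.2 hx2), abs_of_nonneg (sub_nonneg.2 hy2), abs_sub_comm]
      congr 1; ring
  · intro t ht0 ht1
    rcases hend with h | h
    · refine ⟨e ⟨t, ht0, ht1⟩, Subtype.mem _, ?_⟩
      have := hd v' (e ⟨t, ht0, ht1⟩)
      change dist (v : X) _ = _ at this
      rw [this, h, e.symm_apply_apply, zero_sub, abs_neg, abs_of_nonneg ht0]
    · have ht : dist (v : X) w - t ∈ Set.Icc 0 (dist (v : X) w) := ⟨by linarith, by linarith⟩
      refine ⟨e ⟨_, ht⟩, Subtype.mem _, ?_⟩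
      have := hd v' (e ⟨_, ht⟩)
      change dist (v : X) _ = _ at this
      rw [this, h, e.symm_apply_apply, sub_sub_cancel, abs_of_nonneg ht0]

/-- Four-point condition from its three-point form at one base point `v`; here
`d(x, v) + d(y, v) - d(x, y)` is twice the Gromov product of `x` and `y`. -/
theorem fourPoint_of_base {S : Set X} {v : X}
    (h : ∀ x ∈ S, ∀ y ∈ S, ∀ z ∈ S,
      dist x v + dist y v - dist x y ≤ dist x v + dist z v - dist x z ∨
      dist y v + dist z v - dist y z ≤ dist x v + dist z v - dist x z) :
    ∀ a ∈ S, ∀ b ∈ S, ∀ c ∈ S, ∀ d ∈ S,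
      dist a b + dist c d ≤ dist a c + dist b d ∨ dist a b + dist c d ≤ dist a d + dist b c := by
  intro a ha b hb c hc d hd
  by_contra! hlt
  obtain ⟨h1, h2⟩ := hlt
  rcases h a ha c hc b hb with h3 | h3 <;> rcases h a ha d hd b hb with h4 | h4 <;>
    rcases h c hc a ha d hd with h5 | h5 <;> rcases h c hc b hb d hd with h6 | h6 <;>
    rcases le_total (dist a v + dist b v - dist a b) (dist c v + dist d v - dist c d)
      with h7 | h7 <;>
    linarith [dist_comm c a, dist_comm c b, dist_comm d b]

/-- Gluing two sets along a point preserves the four-point condition. -/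
theorem fourPoint_union {A B : Set X} {v : X} (hvA : v ∈ A) (hvB : v ∈ B)
    (hA : ∀ a ∈ A, ∀ b ∈ A, ∀ c ∈ A, ∀ d ∈ A,
      dist a b + dist c d ≤ dist a c + dist b d ∨ dist a b + dist c d ≤ dist a d + dist b c)
    (hB : ∀ a ∈ B, ∀ b ∈ B, ∀ c ∈ B, ∀ d ∈ B,
      dist a b + dist c d ≤ dist a c + dist b d ∨ dist a b + dist c d ≤ dist a d + dist b c)
    (hAB : ∀ a ∈ A, ∀ b ∈ B, dist a b = dist a v + dist v b) :
    ∀ a ∈ A ∪ B, ∀ b ∈ A ∪ B, ∀ c ∈ A ∪ B, ∀ d ∈ A ∪ B,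
      dist a b + dist c d ≤ dist a c + dist b d ∨ dist a b + dist c d ≤ dist a d + dist b c := by
  refine fourPoint_of_base (v := v) ?_
  intro x hx y hy z hz
  have c1 := dist_comm v x
  have c2 := dist_comm v y
  have c3 := dist_comm v z
  have t := dist_triangle_right x z v
  rcases hx with hx | hx <;> rcases hy with hy | hy <;> rcases hz with hz | hz
  · rcases hA x hx z hz v hvA y hy with h | h
    · right; linarith [dist_comm z y]
    · left; linarith
  · right; linarith [hAB y hy z hz]
  · left; linarith [hAB x hx y hy]
  · left; linarith [hAB x hx y hy]
  · left; linarith [hAB y hy x hx, dist_comm x y]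
  · left; linarith [hAB y hy x hx, dist_comm x y]
  · right; linarith [hAB z hz y hy, dist_comm z y]
  · rcases hB x hx z hz v hvB y hy with h | h
    · right; linarith [dist_comm z y]
    · left; linarith

variable (T : SimplicialRealTree X)

/-- The union of the vertices in `S` and of the edges with both ends in `S`. -/
def realization (S : Set T.verts) : Set X :=
  {x | (∃ v ∈ S, x = (v : X)) ∨
    ∃ v ∈ S, ∃ w ∈ S, T.graph.Adj v w ∧ x ∈ metricSegment (v : X) (w : X)}

/-- A set of vertices spanning a subtree whose realization is geodesic and satisfies the four-point
condition. -/
structure IsRealSubtree (S : Set T.verts) : Prop where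
  nonempty : S.Nonempty
  exists_path : ∀ a ∈ S, ∀ b ∈ S, ∃ p : T.graph.Walk a b, p.IsPath ∧ ∀ u ∈ p.support, u ∈ S
  exists_between : ∀ x ∈ T.realization S, ∀ y ∈ T.realization S, ∀ t, 0 ≤ t → t ≤ dist x y →
    ∃ z, dist x z = t ∧ dist z y = dist x y - t
  fourPoint : ∀ a ∈ T.realization S, ∀ b ∈ T.realization S, ∀ c ∈ T.realization S,
    ∀ d ∈ T.realization S,
    dist a b + dist c d ≤ dist a c + dist b d ∨ dist a b + dist c d ≤ dist a d + dist b c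

variable {T}

theorem realization_mono {S S' : Set T.verts} (h : S ⊆ S') :
    T.realization S ⊆ T.realization S' := by
  rintro x (⟨v, hv, rfl⟩ | ⟨v, hv, w, hw, hvw, hx⟩)
  · exact Or.inl ⟨v, h hv, rfl⟩
  · exact Or.inr ⟨v, h hv, w, h hw, hvw, hx⟩

theorem isRealSubtree_singleton (v : T.verts) : T.IsRealSubtree {v} := by
  have hr : ∀ x ∈ T.realization {v}, x = v := by
    rintro x (⟨v', hv, rfl⟩ | ⟨a, ha, b, hb, hab, -⟩)
    · rw [Set.mem_singleton_iff.1 hv]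
    · rw [Set.mem_singleton_iff] at ha hb
      subst ha hb
      exact absurd hab (T.graph.loopless.irrefl _)
  refine ⟨⟨v, rfl⟩, ?_, ?_, ?_⟩
  · rintro a rfl b rfl
    exact ⟨.nil, by simp, by simp⟩
  · intro x hx y hy t ht0 ht1
    rw [hr x hx, hr y hy] at *
    simp only [dist_self] at *
    exact ⟨v, by simp; linarith, by simp; linarith⟩
  · intro a ha b hb c hc d hd
    rw [hr a ha, hr b hb, hr c hc, hr d hd]
    simp

/-- Adding a neighbour `w` of a vertex `v` of the subtree glues the edge `[v, w]` at `v`. -/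
theorem IsRealSubtree.insert {S : Set T.verts} (hS : T.IsRealSubtree S) {v w : T.verts}
    (hv : v ∈ S) (hw : w ∉ S) (hvw : T.graph.Adj v w) : T.IsRealSubtree (insert w S) := by
  obtain ⟨hdist, hpar⟩ := T.exists_edge_coord hvw
  have hpath : ∀ a ∈ S, ∃ p : T.graph.Walk a v,
      p.IsPath ∧ (∀ u ∈ p.support, u ∈ S) ∧ (p.concat hvw).IsPath := by
    intro a ha
    obtain ⟨p, hp, hpS⟩ := hS.exists_path a ha v hv
    exact ⟨p, hp, hpS, (SimpleGraph.Walk.concat_isPath_iff hvw).2 ⟨hp, fun h => hw (hpS _ h)⟩⟩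
  have hsnoc : ∀ a ∈ S, dist (a : X) w = dist (a : X) v + dist (v : X) w := by
    intro a ha
    obtain ⟨p, hp, -, hp'⟩ := hpath a ha
    rw [T.dist_verts _ _ _ hp', T.dist_verts _ _ _ hp]
    simp
  have hglue : ∀ x ∈ T.realization S, ∀ y ∈ metricSegment (v : X) (w : X),
      dist x y = dist x v + dist (v : X) y := by
    have hedge : ∀ a ∈ S, ∀ b ∈ S, T.graph.Adj a b → ∀ x ∈ metricSegment (a : X) (b : X),
        ∀ y ∈ metricSegment (v : X) (w : X), dist x y = dist x v + dist (v : X) y := by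
      intro a ha b hb hab x hx y hy
      refine le_antisymm (dist_triangle _ _ _) ?_
      have hne : s(a, b) ≠ s(v, w) := by
        intro h
        have : w ∈ s(a, b) := h ▸ Sym2.mem_mk_right v w
        rcases Sym2.mem_iff.1 this with rfl | rfl
        exacts [hw ha, hw hb]
      obtain ⟨a', b', ha', hb', h⟩ := T.dist_edges a b v w hab hvw hne x hx y hy
      have haS : a' ∈ S := by rcases ha' with rfl | rfl <;> assumption
      have := dist_triangle x a' v
      rcases hb' with rfl | rfl
      · linarith
      · have := hsnoc a' haS
        linarith [dist_triangle (v : X) b' y]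
    rintro x (⟨a, ha, rfl⟩ | ⟨a, ha, b, hb, hab, hx⟩) y hy
    · obtain ⟨p, -, hpS, -⟩ := hpath a ha
      cases p with
      | nil => simp
      | cons hab p =>
        exact hedge a ha _ (hpS _ (by simp)) hab _ (left_mem_metricSegment _ _) y hy
    · exact hedge a ha b hb hab x hx y hy
  have hadj : ∀ b ∈ S, T.graph.Adj b w → b = v := by
    intro b hb hbw
    obtain ⟨p, -, -, hp'⟩ := hpath b hb
    have h1 : (SimpleGraph.Walk.cons hbw .nil).IsPath := by
      simp [hbw.ne]
    have := congrArg SimpleGraph.Walk.length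
      ((T.isTree.existsUnique_path b w).unique hp' h1)
    simp only [SimpleGraph.Walk.length_concat, SimpleGraph.Walk.length_cons,
      SimpleGraph.Walk.length_nil] at this
    exact SimpleGraph.Walk.eq_of_length_eq_zero (p := p) (by omega)
  have hsub : T.realization (Insert.insert w S) ⊆
      T.realization S ∪ metricSegment (v : X) (w : X) := by
    rintro x (⟨a, ha, rfl⟩ | ⟨a, ha, b, hb, hab, hx⟩)
    · rcases ha with rfl | ha
      · exact Or.inr (right_mem_metricSegment _ _)
      · exact Or.inl (Or.inl ⟨a, ha, rfl⟩)
    · rcases ha with rfl | ha <;> rcases hb with rfl | hb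
      · exact absurd hab (T.graph.loopless.irrefl _)
      · right
        rw [← hadj b hb hab.symm, metricSegment_comm]
        exact hx
      · right
        rwa [← hadj a ha hab]
      · exact Or.inl (Or.inr ⟨a, ha, b, hb, hab, hx⟩)
  have hvr : (v : X) ∈ T.realization S := Or.inl ⟨v, hv, rfl⟩
  refine ⟨⟨w, Or.inl rfl⟩, ?_, ?_, ?_⟩
  · rintro a (rfl | ha) b (rfl | hb)
    · exact ⟨.nil, by simp, by simp⟩
    · obtain ⟨p, -, hpS, hp'⟩ := hpath b hb
      refine ⟨(p.concat hvw).reverse, hp'.reverse, fun u hu => ?_⟩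
      simp only [SimpleGraph.Walk.support_reverse, SimpleGraph.Walk.support_concat,
        List.mem_reverse, List.mem_append, List.mem_singleton] at hu
      rcases hu with hu | rfl
      exacts [Or.inr (hpS _ hu), Or.inl rfl]
    · obtain ⟨p, -, hpS, hp'⟩ := hpath a ha
      refine ⟨p.concat hvw, hp', fun u hu => ?_⟩
      simp only [SimpleGraph.Walk.support_concat,
        List.mem_append, List.mem_singleton] at hu
      rcases hu with hu | rfl
      exacts [Or.inr (hpS _ hu), Or.inl rfl]
    · obtain ⟨p, hp, hpS⟩ := hS.exists_path a ha b hb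
      exact ⟨p, hp, fun u hu => Or.inr (hpS u hu)⟩
  · have cross : ∀ x ∈ T.realization S, ∀ y ∈ metricSegment (v : X) (w : X), ∀ t, 0 ≤ t →
        t ≤ dist x y → ∃ z, dist x z = t ∧ dist z y = dist x y - t := by
      intro x hx y hy t ht0 ht1
      have hxy := hglue x hx y hy
      rcases le_total t (dist x v) with ht | ht
      · obtain ⟨z, hz1, hz2⟩ := hS.exists_between x hx v hvr t ht0 ht
        refine ⟨z, hz1, le_antisymm ?_ ?_⟩
        · linarith [dist_triangle z v y]
        · linarith [dist_triangle x z y]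
      · have hy' : dist (v : X) y + dist y w = dist (v : X) w := hy
        obtain ⟨z, hz1, hz2⟩ := hpar (t - dist x v) (by linarith)
          (by linarith [dist_nonneg (x := y) (y := (w : X))])
        have := hglue x hx z hz1
        refine ⟨z, by linarith, ?_⟩
        rw [hdist z hz1 y hy, hz2, abs_sub_comm, abs_of_nonneg (by linarith)]
        linarith
    intro x hx y hy t ht0 ht1
    rcases hsub hx with hx | hx <;> rcases hsub hy with hy | hy
    · exact hS.exists_between x hx y hy t ht0 ht1
    · exact cross x hx y hy t ht0 ht1
    · obtain ⟨z, hz1, hz2⟩ := cross y hy x hx (dist x y - t) (by linarith)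
        (by rw [dist_comm]; linarith)
      exact ⟨z, by rw [dist_comm, hz2, dist_comm y x]; ring, by rw [dist_comm, hz1]⟩
    · have e := hdist x hx y hy
      have hx' : dist (v : X) x + dist x w = dist (v : X) w := hx
      have hy' : dist (v : X) y + dist y w = dist (v : X) w := hy
      have := dist_nonneg (x := x) (y := (w : X))
      have := dist_nonneg (x := y) (y := (w : X))
      have := dist_nonneg (x := (v : X)) (y := x)
      have := dist_nonneg (x := (v : X)) (y := y)
      rcases le_total (dist (v : X) x) (dist (v : X) y) with hle | hle
      · rw [abs_of_nonpos (by linarith)] at e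
        obtain ⟨z, hz1, hz2⟩ := hpar (dist (v : X) x + t) (by linarith) (by linarith)
        refine ⟨z, ?_, ?_⟩
        · rw [hdist x hx z hz1, hz2, abs_of_nonpos (by linarith)]; ring
        · rw [hdist z hz1 y hy, hz2, abs_of_nonpos (by linarith)]; linarith
      · rw [abs_of_nonneg (by linarith)] at e
        obtain ⟨z, hz1, hz2⟩ := hpar (dist (v : X) x - t) (by linarith) (by linarith)
        refine ⟨z, ?_, ?_⟩
        · rw [hdist x hx z hz1, hz2, abs_of_nonneg (by linarith)]; ring
        · rw [hdist z hz1 y hy, hz2, abs_of_nonneg (by linarith)]; linarith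
  · have hsegm : ∀ a ∈ metricSegment (v : X) (w : X), ∀ b ∈ metricSegment (v : X) (w : X),
        ∀ c ∈ metricSegment (v : X) (w : X), ∀ d ∈ metricSegment (v : X) (w : X),
        dist a b + dist c d ≤ dist a c + dist b d ∨
          dist a b + dist c d ≤ dist a d + dist b c := by
      intro a ha b hb c hc d hd
      rw [hdist a ha b hb, hdist c hc d hd, hdist a ha c hc, hdist b hb d hd, hdist a ha d hd,
        hdist b hb c hc]
      generalize dist (v : X) a = a
      generalize dist (v : X) b = b
      generalize dist (v : X) c = c
      generalize dist (v : X) d = d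
      by_contra! h
      obtain ⟨h1, h2⟩ := h
      rcases le_total a b with h3 | h3 <;> rcases le_total c d with h4 | h4 <;>
        simp only [abs_of_nonpos (sub_nonpos.2 h3), abs_of_nonpos (sub_nonpos.2 h4),
          abs_of_nonneg (sub_nonneg.2 h3), abs_of_nonneg (sub_nonneg.2 h4)] at h1 h2 <;>
        linarith [le_abs_self (a - c), neg_abs_le (a - c), le_abs_self (b - d),
          neg_abs_le (b - d), le_abs_self (a - d), neg_abs_le (a - d), le_abs_self (b - c),
          neg_abs_le (b - c)]
    have := fourPoint_union hvr (left_mem_metricSegment (v : X) (w : X)) hS.fourPoint hsegm hglue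
    exact fun a ha b hb c hc d hd => this a (hsub ha) b (hsub hb) c (hsub hc) d (hsub hd)

theorem IsRealSubtree.exists_superset {S : Set T.verts} (hS : T.IsRealSubtree S) {a u : T.verts}
    (p : T.graph.Walk a u) (ha : a ∈ S) : ∃ S', S ⊆ S' ∧ T.IsRealSubtree S' ∧ u ∈ S' := by
  induction p generalizing S with
  | nil => exact ⟨S, subset_rfl, hS, ha⟩
  | @cons a b u hab p ih =>
    by_cases hb : b ∈ S
    · exact ih hS hb
    · obtain ⟨S', h1, h2, h3⟩ := ih (hS.insert ha hb hab) (Or.inl rfl)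
      exact ⟨S', (Set.subset_insert _ _).trans h1, h2, h3⟩

theorem IsRealSubtree.exists_superset_mem {S : Set T.verts} (hS : T.IsRealSubtree S) (x : X) :
    ∃ S', S ⊆ S' ∧ T.IsRealSubtree S' ∧ x ∈ T.realization S' := by
  obtain ⟨a, ha⟩ := hS.nonempty
  rcases T.exists_mem_edge x with hx | ⟨v, w, hvw, hx⟩
  · obtain ⟨p⟩ := T.isTree.connected.preconnected a ⟨x, hx⟩
    obtain ⟨S', h1, h2, h3⟩ := hS.exists_superset p ha
    exact ⟨S', h1, h2, Or.inl ⟨_, h3, rfl⟩⟩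
  · obtain ⟨p⟩ := T.isTree.connected.preconnected a v
    obtain ⟨S', h1, h2, h3⟩ := hS.exists_superset p ha
    obtain ⟨S'', k1, k2, k3⟩ := h2.exists_superset (.cons hvw .nil) h3
    exact ⟨S'', h1.trans k1, k2, Or.inr ⟨v, k1 h3, w, k3, hvw, hx⟩⟩

theorem isRealTree (T : SimplicialRealTree X) : IsRealTree X := by
  obtain ⟨v⟩ := T.isTree.connected.nonempty
  have four : ∀ a b c d : X, ∃ S, T.IsRealSubtree S ∧ a ∈ T.realization S ∧
      b ∈ T.realization S ∧ c ∈ T.realization S ∧ d ∈ T.realization S := by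
    intro a b c d
    obtain ⟨S₁, -, h1, ha⟩ := (isRealSubtree_singleton v).exists_superset_mem a
    obtain ⟨S₂, i2, h2, hb⟩ := h1.exists_superset_mem b
    obtain ⟨S₃, i3, h3, hc⟩ := h2.exists_superset_mem c
    obtain ⟨S₄, i4, h4, hd⟩ := h3.exists_superset_mem d
    exact ⟨S₄, h4, realization_mono (i2.trans (i3.trans i4)) ha,
      realization_mono (i3.trans i4) hb, realization_mono i4 hc, hd⟩
  refine ⟨fun x y => ?_, fun a b c d => ?_⟩
  · obtain ⟨S, hS, hx, hy, -⟩ := four x y x x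
    exact hS.exists_between x hx y hy
  · obtain ⟨S, hS, ha, hb, hc, hd⟩ := four a b c d
    exact le_max_iff.2 (hS.fourPoint a ha b hb c hc d hd)

end SimplicialRealTree

/-! ### Translation lengths and discrete groups of isometries -/

namespace SimplicialRealTree

variable {X : Type*} [MetricSpace X] {T : SimplicialRealTree X}

theorem nonempty (T : SimplicialRealTree X) : Nonempty X :=
  T.isTree.connected.nonempty.map Subtype.val

theorem translationLength_le (g : T.Isom) (x : X) :
    translationLength g ≤ dist x ((g : X ≃ᵢ X) x) :=
  ciInf_le ⟨0, by rintro _ ⟨y, rfl⟩; exact dist_nonneg⟩ x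

theorem le_translationLength {g : T.Isom} {c : ℝ} (h : ∀ x, c ≤ dist x ((g : X ≃ᵢ X) x)) :
    c ≤ translationLength g :=
  have := T.nonempty
  le_ciInf h

theorem translationLength_nonneg (g : T.Isom) : 0 ≤ translationLength g :=
  le_translationLength fun _ => dist_nonneg

theorem exists_dist_eq_translationLength (g : T.Isom) :
    ∃ q, dist q ((g : X ≃ᵢ X) q) = translationLength g := by
  have := T.nonempty
  obtain ⟨q, hq⟩ := T.isRealTree.exists_min_displacement (g : X ≃ᵢ X)
  exact ⟨q, le_antisymm (le_translationLength hq) (translationLength_le g q)⟩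

theorem translationLength_conj_le (g h : T.Isom) :
    translationLength (h * g * h⁻¹) ≤ translationLength g := by
  refine le_translationLength fun x => ?_
  refine (translationLength_le _ ((h : X ≃ᵢ X) x)).trans_eq ?_
  simp [IsometryEquiv.mul_apply, IsometryEquiv.dist_eq]

theorem translationLength_conj (g h : T.Isom) :
    translationLength (h * g * h⁻¹) = translationLength g := by
  refine le_antisymm (translationLength_conj_le g h) ?_
  simpa [mul_assoc] using translationLength_conj_le (h * g * h⁻¹) h⁻¹

/-- `Isom(X)` acts on the vertices. -/
instance vertexAction (T : SimplicialRealTree X) : MulAction T.Isom T.verts where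
  smul g v := ⟨(g : X ≃ᵢ X) v, by obtain ⟨φ, hφ⟩ := g.2; rw [hφ]; exact (φ v).2⟩
  one_smul _ := rfl
  mul_smul _ _ _ := rfl

theorem coe_smul (g : T.Isom) (v : T.verts) : ((g • v : T.verts) : X) = (g : X ≃ᵢ X) v := rfl

theorem coe_smul_subgroup {Γ : Subgroup T.Isom} (g : Γ) (v : T.verts) :
    ((g • v : T.verts) : X) = ((g : T.Isom) : X ≃ᵢ X) v := rfl

theorem adj_smul (g : T.Isom) {v w : T.verts} :
    T.graph.Adj (g • v) (g • w) ↔ T.graph.Adj v w := by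
  obtain ⟨φ, hφ⟩ := g.2
  have h : ∀ v : T.verts, g • v = φ v := fun v => Subtype.ext (hφ v)
  rw [h, h, φ.map_adj_iff]

theorem dist_smul_smul (g : T.Isom) (v w : T.verts) :
    dist ((g • v : T.verts) : X) ((g • w : T.verts) : X) = dist (v : X) w :=
  (g : X ≃ᵢ X).dist_eq _ _

theorem dist_pos_of_adj {v w : T.verts} (h : T.graph.Adj v w) : 0 < dist (v : X) w :=
  dist_pos.2 fun e => h.ne (Subtype.ext e)

theorem ValenceGeTwo.exists_edge (hT : T.ValenceGeTwo) (x : X) :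
    ∃ v w : T.verts, T.graph.Adj v w ∧ x ∈ metricSegment (v : X) (w : X) := by
  rcases T.exists_mem_edge x with hx | h
  · obtain ⟨w, -, -, hw, -⟩ := hT ⟨x, hx⟩
    exact ⟨⟨x, hx⟩, w, hw, left_mem_metricSegment _ _⟩
  · exact h

theorem ValenceGeTwo.nonempty_dart (hT : T.ValenceGeTwo) : Nonempty T.graph.Dart := by
  obtain ⟨v⟩ := T.isTree.connected.nonempty
  obtain ⟨w, -, -, hw, -⟩ := hT v
  exact ⟨⟨(v, w), hw⟩⟩

/-- A function on edges that is invariant under a group with finite quotient attains its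
maximum. -/
theorem exists_max_on_edges (hT : T.ValenceGeTwo) (Γ : Subgroup T.Isom)
    [Finite (T.QuotientEdges Γ)] (u : T.verts → T.verts → ℝ)
    (hu : ∀ (γ : Γ) v w, T.graph.Adj v w → u (γ • v) (γ • w) = u v w) :
    ∃ v₀ w₀, T.graph.Adj v₀ w₀ ∧ ∀ v w, T.graph.Adj v w → u v w ≤ u v₀ w₀ := by
  have := hT.nonempty_dart
  let U : T.QuotientEdges Γ → ℝ := Quotient.lift (fun d : T.graph.Dart => u d.fst d.snd) (by
    rintro d e ⟨γ, hγ, h1, h2⟩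
    have e1 : (⟨γ, hγ⟩ : Γ) • d.fst = e.fst := Subtype.ext h1
    have e2 : (⟨γ, hγ⟩ : Γ) • d.snd = e.snd := Subtype.ext h2
    change u d.fst d.snd = u e.fst e.snd
    rw [← e1, ← e2, hu _ _ _ d.adj])
  have : Nonempty (T.QuotientEdges Γ) := ⟨Quotient.mk _ (Classical.arbitrary _)⟩
  obtain ⟨q, hq⟩ := Finite.exists_max U
  obtain ⟨d, rfl⟩ := Quotient.exists_rep q
  exact ⟨d.fst, d.snd, d.adj, fun v w h => hq (Quotient.mk _ ⟨(v, w), h⟩)⟩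

theorem exists_edge_length_le (hT : T.ValenceGeTwo) (Γ : Subgroup T.Isom)
    [Finite (T.QuotientEdges Γ)] :
    ∃ L : ℝ, ∀ v w : T.verts, T.graph.Adj v w → dist (v : X) w ≤ L := by
  obtain ⟨v, w, -, h⟩ := exists_max_on_edges hT Γ (fun v w => dist (v : X) w)
    (fun γ v w _ => dist_smul_smul (γ : T.Isom) v w)
  exact ⟨_, h⟩

theorem exists_le_edge_length (hT : T.ValenceGeTwo) (Γ : Subgroup T.Isom)
    [Finite (T.QuotientEdges Γ)] :
    ∃ l : ℝ, 0 < l ∧ ∀ v w : T.verts, T.graph.Adj v w → l ≤ dist (v : X) w := by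
  obtain ⟨v, w, hvw, h⟩ := exists_max_on_edges hT Γ (fun v w => -dist (v : X) w)
    (fun γ v w _ => congrArg Neg.neg (dist_smul_smul (γ : T.Isom) v w))
  exact ⟨_, dist_pos_of_adj hvw, fun a b hab => neg_le_neg_iff.1 (h a b hab)⟩

theorem LocallyFinite.finite_walk_length (hfin : T.LocallyFinite) (n : ℕ) (v : T.verts) :
    {w | ∃ p : T.graph.Walk v w, p.length = n}.Finite := by
  induction n generalizing v with
  | zero =>
    refine (Set.finite_singleton v).subset ?_
    rintro w ⟨p, hp⟩
    exact (SimpleGraph.Walk.eq_of_length_eq_zero hp).symm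
  | succ n ih =>
    refine ((hfin v).biUnion fun u _ => ih u).subset ?_
    rintro w ⟨p, hp⟩
    cases p with
    | nil => simp at hp
    | cons h p => exact Set.mem_biUnion h ⟨p, by simpa using hp⟩

/-- Balls of a cocompact locally finite tree contain finitely many vertices. -/
theorem finite_verts_dist_le (hT : T.ValenceGeTwo) (hfin : T.LocallyFinite)
    (Γ : Subgroup T.Isom) [Finite (T.QuotientEdges Γ)] (x : X) (R : ℝ) :
    {v : T.verts | dist x (v : X) ≤ R}.Finite := by
  obtain ⟨l, hl, hle⟩ := exists_le_edge_length hT Γ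
  obtain ⟨v₀⟩ := T.isTree.connected.nonempty
  refine ((Set.finite_Iic ⌊(dist (v₀ : X) x + R) / l⌋₊).biUnion
    fun n _ => hfin.finite_walk_length n v₀).subset ?_
  intro w hw
  obtain ⟨p, hp, -⟩ := T.isTree.existsUnique_path v₀ w
  refine Set.mem_biUnion ?_ ⟨p, rfl⟩
  refine Set.mem_Iic.2 (Nat.le_floor ?_)
  rw [le_div_iff₀ hl]
  have h1 := T.dist_verts v₀ w p hp
  have h2 := List.card_nsmul_le_sum (p.darts.map fun d => dist (d.fst : X) (d.snd : X)) l (by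
    intro r hr
    obtain ⟨d, -, rfl⟩ := List.mem_map.1 hr
    exact hle _ _ d.adj)
  rw [List.length_map, SimpleGraph.Walk.length_darts, nsmul_eq_mul, ← h1] at h2
  have h3 : dist x (w : X) ≤ R := hw
  linarith [dist_triangle (v₀ : X) x w]

theorem eq_of_fix_ends (g : T.Isom) {v w : T.verts} (hv : g • v = v) (hw : g • w = w) {z : X}
    (hz : z ∈ metricSegment (v : X) (w : X)) : (g : X ≃ᵢ X) z = z := by
  have e1 := (g : X ≃ᵢ X).dist_eq v z
  have e2 := (g : X ≃ᵢ X).dist_eq z w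
  rw [← coe_smul, hv] at e1
  rw [← coe_smul g w, hw] at e2
  refine T.isRealTree.eq_of_mem_segment (x := (v : X)) (y := w) ?_ hz e1
  rw [e1, e2]; exact hz

/-- A discrete group acts properly: only finitely many of its elements displace a given point by a
bounded amount. -/
theorem finite_dist_le (hT : T.ValenceGeTwo) (hfin : T.LocallyFinite)
    (Γ : Subgroup T.Isom) [DiscreteTopology Γ] [Finite (T.QuotientEdges Γ)] (x : X) (R : ℝ) :
    {γ : Γ | dist x (((γ : T.Isom) : X ≃ᵢ X) x) ≤ R}.Finite := by
  obtain ⟨U, hU, hU1⟩ := isOpen_induced_iff.1 (isOpen_discrete ({1} : Set Γ))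
  have h1U : (1 : T.Isom) ∈ U := by
    have : (1 : Γ) ∈ Subtype.val ⁻¹' U := hU1 ▸ rfl
    exact this
  obtain ⟨K, hK, hKU⟩ := hU 1 h1U
  obtain ⟨L, hL⟩ := exists_edge_length_le hT Γ
  obtain ⟨R₀, hR₀⟩ := hK.isBounded.subset_closedBall x
  -- the vertices of the edges meeting `K`
  let W : Set T.verts := {v | dist x (v : X) ≤ R₀ + L}
  let W' : Set T.verts := {v | dist x (v : X) ≤ R₀ + L + R}
  have hW : Finite W := finite_verts_dist_le hT hfin Γ x _
  have hW' : Finite W' := finite_verts_dist_le hT hfin Γ x _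
  have hone : ∀ γ : Γ, (∀ w ∈ W, γ • w = w) → γ = 1 := by
    intro γ hγ
    have : (γ : T.Isom) ∈ U := by
      refine hKU γ fun z hz => ?_
      obtain ⟨v, w, hvw, hzvw⟩ := hT.exists_edge z
      have hzx : dist z x ≤ R₀ := hR₀ hz
      have hzvw' : dist (v : X) z + dist z w = dist (v : X) w := hzvw
      have hlen := hL v w hvw
      have hv : v ∈ W := by
        change dist x (v : X) ≤ R₀ + L
        linarith [dist_triangle x z v, dist_comm x z, dist_comm z v,
          dist_nonneg (x := z) (y := (w : X))]
      have hw : w ∈ W := by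
        change dist x (w : X) ≤ R₀ + L
        linarith [dist_triangle x z w, dist_comm x z, dist_nonneg (x := (v : X)) (y := z)]
      exact eq_of_fix_ends (γ : T.Isom) (hγ v hv) (hγ w hw) hzvw
    have : γ ∈ Subtype.val ⁻¹' U := this
    rw [hU1] at this
    exact this
  let F : {γ : Γ | dist x (((γ : T.Isom) : X ≃ᵢ X) x) ≤ R} → W → W' := fun γ w =>
    ⟨γ.1 • w.1, by
      have h1 : dist x (((γ.1 : T.Isom) : X ≃ᵢ X) x) ≤ R := γ.2
      have h2 : dist x (w.1 : X) ≤ R₀ + L := w.2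
      have h3 := ((γ.1 : T.Isom) : X ≃ᵢ X).dist_eq x w.1
      change dist x (((γ.1 : T.Isom) : X ≃ᵢ X) w.1) ≤ R₀ + L + R
      linarith [dist_triangle x (((γ.1 : T.Isom) : X ≃ᵢ X) x) (((γ.1 : T.Isom) : X ≃ᵢ X) w.1)]⟩
  have hF : Function.Injective F := by
    intro γ δ h
    have := hone (δ.1⁻¹ * γ.1) fun w hw => by
      have := congrArg Subtype.val (congrFun h ⟨w, hw⟩)
      change γ.1 • w = δ.1 • w at this
      rw [mul_smul, this, inv_smul_smul]
    exact Subtype.ext (inv_mul_eq_one.1 this).symm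
  exact Finite.of_injective F hF

/-- A discrete torsion-free group acts freely. -/
theorem eq_one_of_fixed_point (hT : T.ValenceGeTwo) (hfin : T.LocallyFinite)
    (Γ : Subgroup T.Isom) [DiscreteTopology Γ] [Finite (T.QuotientEdges Γ)]
    (htorsion : ∀ γ : Γ, IsOfFinOrder γ → γ = 1) {γ : Γ} {x : X}
    (hx : ((γ : T.Isom) : X ≃ᵢ X) x = x) : γ = 1 := by
  refine htorsion γ (by_contra fun hγ => ?_)
  refine Set.infinite_of_injective_forall_mem (injective_pow_iff_not_isOfFinOrder.2 hγ)
    (fun n => ?_) (finite_dist_le hT hfin Γ x 0)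
  have : (((γ ^ n : Γ) : T.Isom) : X ≃ᵢ X) x = x := by
    induction n with
    | zero => rfl
    | succ n ih =>
      rw [pow_succ, Subgroup.coe_mul, Subgroup.coe_mul, IsometryEquiv.mul_apply, hx, ih]
  simp only [Set.mem_ofPred_eq]
  rw [this, dist_self]

end SimplicialRealTree

/-! ### Equivariant maps and their values on vertices -/

/-- Equivariant choice: for a free action, a solvable invariant condition can be solved
equivariantly. -/
theorem exists_equivariant_choice {Γ V Z : Type*} [Group Γ] [MulAction Γ V] [MulAction Γ Z]
    (hfree : ∀ (γ : Γ) (v : V), γ • v = v → γ = 1) (P : V → Z → Prop)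
    (hP : ∀ (γ : Γ) v z, P v z → P (γ • v) (γ • z)) (h : ∀ v, ∃ z, P v z) :
    ∃ s : V → Z, (∀ (γ : Γ) v, s (γ • v) = γ • s v) ∧ ∀ v, P v (s v) := by
  choose s₀ hs₀ using h
  let rep : V → V := fun v => (Quotient.mk (MulAction.orbitRel Γ V) v).out
  have hrep : ∀ v, ∃ γ : Γ, γ • rep v = v := fun v => by
    have : (MulAction.orbitRel Γ V) (rep v) v := Quotient.mk_out v
    obtain ⟨γ, hγ⟩ := MulAction.orbitRel_apply.1 ((MulAction.orbitRel Γ V).symm this)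
    exact ⟨γ, hγ⟩
  have hrep_smul : ∀ (γ : Γ) v, rep (γ • v) = rep v := fun γ v => by
    have : Quotient.mk (MulAction.orbitRel Γ V) (γ • v) = Quotient.mk _ v :=
      Quotient.sound (MulAction.orbitRel_apply.2 ⟨γ, rfl⟩)
    simp only [rep, this]
  choose g hg using hrep
  refine ⟨fun v => g v • s₀ (rep v), fun γ v => ?_, fun v => ?_⟩
  · have : g (γ • v) = γ * g v := by
      have h1 := hg (γ • v)
      rw [hrep_smul] at h1
      have h2 : ((γ * g v)⁻¹ * g (γ • v)) • rep v = rep v := by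
        rw [mul_smul, h1, inv_smul_eq_iff, mul_smul, hg]
      exact (inv_mul_eq_one.1 (hfree _ _ h2)).symm
    simp only [hrep_smul, this, mul_smul]
  · have := hP (g v) _ _ (hs₀ (rep v))
    rwa [hg] at this

/-- The action on `Y` given by a homomorphism to its isometry group. -/
abbrev isometryAction {Γ Y : Type*} [Group Γ] [MetricSpace Y] (ψ : Γ →* (Y ≃ᵢ Y)) :
    MulAction Γ Y where
  smul g y := ψ g y
  one_smul y := by change ψ 1 y = y; simp
  mul_smul g h y := by change ψ (g * h) y = ψ g (ψ h y); simp

namespace SimplicialRealTree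

variable {X Y : Type*} [MetricSpace X] [MetricSpace Y] {T : SimplicialRealTree X}

/-- Distinct edges meet at most in a common end. -/
theorem eq_end_of_mem_two_edges {v w v' w' : T.verts} (h : T.graph.Adj v w)
    (h' : T.graph.Adj v' w') (hne : s(v, w) ≠ s(v', w')) {z : X}
    (hz : z ∈ metricSegment (v : X) (w : X)) (hz' : z ∈ metricSegment (v' : X) (w' : X)) :
    (z = v ∨ z = w) ∧ (z = v' ∨ z = w') := by
  obtain ⟨a, b, ha, hb, hd⟩ := T.dist_edges v w v' w' h h' hne z hz z hz'
  rw [dist_self] at hd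
  have h1 : z = a := dist_le_zero.1 (by
    linarith [dist_nonneg (x := (a : X)) (y := (b : X)), dist_nonneg (x := (b : X)) (y := z)])
  have h2 : (b : X) = z := dist_le_zero.1 (by
    linarith [dist_nonneg (x := (a : X)) (y := (b : X)), dist_nonneg (x := z) (y := (a : X))])
  constructor
  · rcases ha with rfl | rfl
    exacts [Or.inl h1, Or.inr h1]
  · rcases hb with rfl | rfl
    exacts [Or.inl h2.symm, Or.inr h2.symm]

/-- `y` divides `[F v, F w]` in the same ratio as `z` divides `[v, w]`, for every edge `[v, w]`
containing `z`. -/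
def IsAffineValue (T : SimplicialRealTree X) (F : T.verts → Y) (z : X) (y : Y) : Prop :=
  ∀ v w : T.verts, T.graph.Adj v w → z ∈ metricSegment (v : X) (w : X) →
    dist (F v) y * dist (v : X) w = dist (v : X) z * dist (F v) (F w) ∧
    dist y (F w) * dist (v : X) w = dist z (w : X) * dist (F v) (F w)

theorem exists_isAffineValue (hY : IsRealTree Y) (hT : T.ValenceGeTwo) (F : T.verts → Y) (z : X) :
    ∃ y, T.IsAffineValue F z y := by
  obtain ⟨v, w, hvw, hz⟩ := hT.exists_edge z
  have hpos := dist_pos_of_adj hvw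
  have hz' : dist (v : X) z + dist z w = dist (v : X) w := hz
  obtain ⟨y, hy1, hy2⟩ := hY.exists_between (F v) (F w)
    (dist (v : X) z / dist (v : X) w * dist (F v) (F w)) (by positivity)
    (mul_le_of_le_one_left dist_nonneg
      ((div_le_one hpos).2 (by linarith [dist_nonneg (x := z) (y := (w : X))])))
  have k1 : dist (F v) y * dist (v : X) w = dist (v : X) z * dist (F v) (F w) := by
    rw [hy1]; field_simp
  have k2 : dist y (F w) * dist (v : X) w = dist z (w : X) * dist (F v) (F w) := by
    rw [hy2, show dist z (w : X) = dist (v : X) w - dist (v : X) z by linarith]; field_simp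
  refine ⟨y, fun v' w' hvw' hzw => ?_⟩
  by_cases hs : s(v, w) = s(v', w')
  · rcases Sym2.eq_iff.1 hs with ⟨rfl, rfl⟩ | ⟨rfl, rfl⟩
    · exact ⟨k1, k2⟩
    · rw [dist_comm (F w) y, dist_comm (w : X) v, dist_comm (w : X) z, dist_comm (F w) (F v),
        dist_comm y (F v), dist_comm z (v : X)]
      exact ⟨k2, k1⟩
  · -- `z` is a common vertex of the two edges, and `y` its image
    have hyF : ∀ u : T.verts, z = u → y = F u := by
      rintro u rfl
      rcases (eq_end_of_mem_two_edges hvw hvw' hs hz hzw).1 with h | h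
      · rw [h, dist_self, zero_mul] at k1
        have h0 : F v = y :=
          dist_eq_zero.1 ((mul_eq_zero.1 k1).resolve_right hpos.ne')
        rw [← h0, Subtype.ext h]
      · rw [h, dist_self, zero_mul] at k2
        have h0 : y = F w :=
          dist_eq_zero.1 ((mul_eq_zero.1 k2).resolve_right hpos.ne')
        rw [h0, Subtype.ext h]
    rcases (eq_end_of_mem_two_edges hvw hvw' hs hz hzw).2 with h | h
    · rw [hyF _ h, h]; simp [mul_comm]
    · rw [hyF _ h, h]; simp [mul_comm]

theorem IsAffineValue.add_eq {F : T.verts → Y} {z : X} {y : Y} (h : T.IsAffineValue F z y)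
    {v w : T.verts} (hvw : T.graph.Adj v w) (hz : z ∈ metricSegment (v : X) (w : X)) :
    dist (F v) y + dist y (F w) = dist (F v) (F w) := by
  have hpos := dist_pos_of_adj hvw
  obtain ⟨h1, h2⟩ := h v w hvw hz
  have hz' : dist (v : X) z + dist z w = dist (v : X) w := hz
  refine mul_right_cancel₀ hpos.ne' ?_
  rw [add_mul, h1, h2, ← add_mul, hz', mul_comm]

theorem IsAffineValue.unique (hY : IsRealTree Y) (hT : T.ValenceGeTwo) {F : T.verts → Y} {z : X}
    {y y' : Y} (h : T.IsAffineValue F z y) (h' : T.IsAffineValue F z y') : y = y' := by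
  obtain ⟨v, w, hvw, hz⟩ := hT.exists_edge z
  refine hY.eq_of_mem_segment (h.add_eq hvw hz) (h'.add_eq hvw hz) ?_
  refine mul_right_cancel₀ (dist_pos_of_adj hvw).ne' ?_
  rw [(h v w hvw hz).1, (h' v w hvw hz).1]

/-- An equivariant map on vertices extends affinely to an equivariant map on the whole tree. -/
theorem exists_piecewiseAffine_extension (hY : IsRealTree Y) (hT : T.ValenceGeTwo)
    {Γ : Subgroup T.Isom} (ψ : Γ →* (Y ≃ᵢ Y)) (F : T.verts → Y)
    (hF : ∀ (γ : Γ) v, F (γ • v) = ψ γ (F v)) :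
    ∃ f : X → Y, T.PiecewiseAffine f ∧
      (∀ (γ : Γ) x, f (((γ : T.Isom) : X ≃ᵢ X) x) = ψ γ (f x)) ∧ ∀ v : T.verts, f v = F v := by
  choose f hf using exists_isAffineValue hY hT F
  refine ⟨f, fun v w hvw => ⟨dist (F v) (F w) / dist (v : X) w, by positivity, ?_⟩,
    fun γ x => ?_, fun v => ?_⟩
  · intro x₁ hx₁ x₂ hx₂
    have hpos := dist_pos_of_adj hvw
    have e : ∀ x ∈ metricSegment (v : X) (w : X),
        dist (F v) (f x) = dist (F v) (F w) / dist (v : X) w * dist (v : X) x := by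
      intro x hx
      rw [div_mul_eq_mul_div, eq_div_iff hpos.ne', (hf x v w hvw hx).1, mul_comm]
    rw [hY.dist_eq_abs_of_mem_segment ((hf x₁).add_eq hvw hx₁) ((hf x₂).add_eq hvw hx₂),
      (T.exists_edge_coord hvw).1 x₁ hx₁ x₂ hx₂, e x₁ hx₁, e x₂ hx₂, ← mul_sub, abs_mul,
      abs_of_nonneg (by positivity)]
  · refine (hf _).unique hY hT fun v w hvw hz => ?_
    obtain ⟨v, rfl⟩ : ∃ v', v = γ • v' := ⟨γ⁻¹ • v, (smul_inv_smul γ v).symm⟩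
    obtain ⟨w, rfl⟩ : ∃ w', w = γ • w' := ⟨γ⁻¹ • w, (smul_inv_smul γ w).symm⟩
    have hz' : x ∈ metricSegment (v : X) (w : X) := by
      simpa only [metricSegment, Set.mem_ofPred_eq, coe_smul_subgroup, IsometryEquiv.dist_eq]
        using hz
    simpa only [hF, coe_smul_subgroup, IsometryEquiv.dist_eq] using
      hf x v w ((adj_smul (γ : T.Isom)).1 hvw) hz'
  · obtain ⟨w, -, -, hvw, -⟩ := hT v
    have h := (hf v v w hvw (left_mem_metricSegment _ _)).1
    rw [dist_self, zero_mul] at h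
    exact (dist_eq_zero.1 ((mul_eq_zero.1 h).resolve_right (dist_pos_of_adj hvw).ne')).symm

/-- The Lipschitz constant of a piecewise affine map can be read off on the edges. -/
theorem PiecewiseAffine.lipschitzWith (hT : T.ValenceGeTwo) {f : X → Y}
    (hf : T.PiecewiseAffine f) {K : ℝ≥0}
    (hK : ∀ v w : T.verts, T.graph.Adj v w → dist (f v) (f w) ≤ K * dist (v : X) w) :
    LipschitzWith K f := by
  have hedge : ∀ v w : T.verts, T.graph.Adj v w → ∀ x ∈ metricSegment (v : X) (w : X),
      ∀ y ∈ metricSegment (v : X) (w : X), dist (f x) (f y) ≤ K * dist x y := by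
    intro v w hvw x hx y hy
    obtain ⟨c, -, h⟩ := hf v w hvw
    rw [h x hx y hy]
    refine mul_le_mul_of_nonneg_right ?_ dist_nonneg
    have := hK v w hvw
    rw [h _ (left_mem_metricSegment _ _) _ (right_mem_metricSegment _ _)] at this
    exact le_of_mul_le_mul_right this (dist_pos_of_adj hvw)
  have hwalk : ∀ (v w : T.verts) (p : T.graph.Walk v w),
      dist (f v) (f w) ≤ K * (p.darts.map fun d => dist (d.fst : X) (d.snd : X)).sum := by
    intro v w p
    induction p with
    | nil => simp
    | @cons a b c hab p ih =>
      simp only [SimpleGraph.Walk.darts_cons, List.map_cons, List.sum_cons, mul_add]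
      linarith [dist_triangle (f a) (f b) (f c), hK a b hab]
  have hverts : ∀ v w : T.verts, dist (f v) (f w) ≤ K * dist (v : X) w := by
    intro v w
    obtain ⟨p, hp, -⟩ := T.isTree.existsUnique_path v w
    rw [T.dist_verts v w p hp]
    exact hwalk v w p
  refine LipschitzWith.of_dist_le_mul fun x y => ?_
  obtain ⟨v, w, hvw, hx⟩ := hT.exists_edge x
  obtain ⟨v', w', hvw', hy⟩ := hT.exists_edge y
  by_cases hs : s(v, w) = s(v', w')
  · refine hedge v w hvw x hx y ?_
    rcases Sym2.eq_iff.1 hs with ⟨rfl, rfl⟩ | ⟨rfl, rfl⟩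
    · exact hy
    · rwa [metricSegment_comm]
  · obtain ⟨a, b, ha, hb, hd⟩ := T.dist_edges v w v' w' hvw hvw' hs x hx y hy
    have h1 : dist (f x) (f a) ≤ K * dist x a := hedge v w hvw x hx a (by
      rcases ha with rfl | rfl
      exacts [left_mem_metricSegment _ _, right_mem_metricSegment _ _])
    have h2 : dist (f b) (f y) ≤ K * dist (b : X) y := hedge v' w' hvw' b (by
      rcases hb with rfl | rfl
      exacts [left_mem_metricSegment _ _, right_mem_metricSegment _ _]) y hy
    rw [hd, mul_add, mul_add]
    linarith [dist_triangle4 (f x) (f a) (f b) (f y), hverts a b]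

theorem PiecewiseAffine.exists_lipschitzWith (hT : T.ValenceGeTwo) {Γ : Subgroup T.Isom}
    [Finite (T.QuotientEdges Γ)] (ψ : Γ →* (Y ≃ᵢ Y)) {f : X → Y} (hf : T.PiecewiseAffine f)
    (hequiv : ∀ (γ : Γ) x, f (((γ : T.Isom) : X ≃ᵢ X) x) = ψ γ (f x)) :
    ∃ K : ℝ≥0, LipschitzWith K f := by
  obtain ⟨a, b, hab, hmax⟩ := exists_max_on_edges hT Γ
    (fun v w => dist (f v) (f w) / dist (v : X) w) (fun γ v w _ => by
      simp only [coe_smul_subgroup, hequiv, IsometryEquiv.dist_eq])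
  refine ⟨⟨dist (f a) (f b) / dist (a : X) b, by positivity⟩,
    hf.lipschitzWith hT fun v w hvw => ?_⟩
  exact (div_le_iff₀ (dist_pos_of_adj hvw)).1 (hmax v w hvw)

end SimplicialRealTree

namespace SimplicialRealTree

variable {X Y : Type*} [MetricSpace X] [MetricSpace Y] {T : SimplicialRealTree X}

/-! ### Tight edges and legal turns -/

/-- The edge `[v, w]` is stretched by the factor `C` exactly. -/
def IsTight (T : SimplicialRealTree X) (F : T.verts → Y) (C : ℝ) (v w : T.verts) : Prop :=
  T.graph.Adj v w ∧ dist (F v) (F w) = C * dist (v : X) w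

/-- The geodesics from `F v` to `F u` and to `F w` have only their origin in common: a path
through `u`, `v`, `w` is mapped without folding at `v`. -/
def IsLegalTurn (F : T.verts → Y) (u v w : T.verts) : Prop :=
  dist (F u) (F w) = dist (F u) (F v) + dist (F v) (F w)

/-- At each end of a tight edge there is another tight edge leaving in a different direction
of `Y`. -/
def HasTightContinuations (T : SimplicialRealTree X) (F : T.verts → Y) (C : ℝ) : Prop :=
  ∀ v w, T.IsTight F C v w → ∃ w', T.IsTight F C v w' ∧ IsLegalTurn F w v w'

theorem IsTight.symm {F : T.verts → Y} {C : ℝ} {v w : T.verts} (h : T.IsTight F C v w) :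
    T.IsTight F C w v := ⟨h.1.symm, by rw [dist_comm, h.2, dist_comm]⟩

theorem isTight_smul {Γ : Subgroup T.Isom} {ψ : Γ →* (Y ≃ᵢ Y)} {F : T.verts → Y}
    (hF : ∀ (γ : Γ) v, F (γ • v) = ψ γ (F v)) {C : ℝ} (γ : Γ) {v w : T.verts} :
    T.IsTight F C (γ • v) (γ • w) ↔ T.IsTight F C v w := by
  simp only [IsTight, hF, coe_smul_subgroup, IsometryEquiv.dist_eq]
  exact and_congr_left' (adj_smul (γ : T.Isom))

theorem isLegalTurn_smul {Γ : Subgroup T.Isom} {ψ : Γ →* (Y ≃ᵢ Y)} {F : T.verts → Y}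
    (hF : ∀ (γ : Γ) v, F (γ • v) = ψ γ (F v)) (γ : Γ) {u v w : T.verts} :
    IsLegalTurn F (γ • u) (γ • v) (γ • w) ↔ IsLegalTurn F u v w := by
  simp only [IsLegalTurn, hF, IsometryEquiv.dist_eq]

/-- If all tight edges at `v` start in the same direction of `Y`, then moving the image of `v`
(and equivariantly of its orbit) slightly in this direction makes all edges at `v` strictly less
stretched than `C`. -/
theorem exists_less_tight (hY : IsRealTree Y) (hfin : T.LocallyFinite) {Γ : Subgroup T.Isom}
    (hfree : ∀ (γ : Γ) (v : T.verts), γ • v = v → γ = 1) (ψ : Γ →* (Y ≃ᵢ Y)) {F : T.verts → Y}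
    (hF : ∀ (γ : Γ) v, F (γ • v) = ψ γ (F v)) {C : ℝ}
    (hFC : ∀ v w, T.graph.Adj v w → dist (F v) (F w) ≤ C * dist (v : X) w)
    {v w : T.verts} (hvw : T.IsTight F C v w)
    (hfold : ∀ b, T.IsTight F C v b → ¬ IsLegalTurn F w v b) :
    ∃ F' : T.verts → Y, (∀ (γ : Γ) v, F' (γ • v) = ψ γ (F' v)) ∧
      (∀ a b, T.graph.Adj a b → dist (F' a) (F' b) ≤ C * dist (a : X) b) ∧
      (∀ a b, T.IsTight F' C a b → T.IsTight F C a b) ∧ ¬ T.IsTight F' C v w := by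
  classical
  let m : T.verts → ℝ := fun b => if T.IsTight F C v b
    then dist (F w) (F v) + dist (F v) (F b) - dist (F w) (F b)
    else C * dist (v : X) b - dist (F v) (F b)
  have hm : ∀ b, T.graph.Adj v b → 0 < m b := by
    intro b hb
    simp only [m]
    split_ifs with h
    · exact sub_pos.2 (lt_of_le_of_ne (dist_triangle _ _ _) (hfold b h))
    · exact sub_pos.2 (lt_of_le_of_ne (hFC v b hb) fun e => h ⟨hb, e⟩)
  obtain ⟨b₀, hb₀, hmin⟩ := Set.exists_min_image (T.graph.neighborSet v) m (hfin v) ⟨w, hvw.1⟩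
  obtain ⟨ε, hε, hεm⟩ : ∃ ε > 0, ∀ b, T.graph.Adj v b → 4 * ε ≤ m b :=
    ⟨m b₀ / 4, by have := hm b₀ hb₀; positivity, fun b hb => by
      have := hmin b hb
      linarith⟩
  have htight : ∀ b, T.IsTight F C v b →
      4 * ε ≤ dist (F w) (F v) + dist (F v) (F b) - dist (F w) (F b) := fun b hb => by
    have := hεm b hb.1
    simp only [m] at this
    rwa [if_pos hb] at this
  have hloose : ∀ b, T.graph.Adj v b → ¬ T.IsTight F C v b →
      4 * ε ≤ C * dist (v : X) b - dist (F v) (F b) := fun b hb h => by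
    have := hεm b hb
    simp only [m] at this
    rwa [if_neg h] at this
  obtain ⟨p, hp1, hp2⟩ := hY.exists_between (F v) (F w) ε hε.le (by
    have := htight w hvw
    rw [dist_self] at this
    linarith [dist_comm (F v) (F w)])
  have fact : ∀ b, T.IsTight F C v b → dist p (F b) ≤ dist (F v) (F b) - ε := by
    intro b hb
    have := htight b hb
    rcases hY.fourPoint_or p (F b) (F v) (F w) with h | h <;>
      linarith [dist_comm p (F v), dist_comm (F w) (F v), dist_comm (F b) (F w),
        dist_comm (F b) (F v)]
  let _ : MulAction Γ Y := isometryAction ψ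
  obtain ⟨F', hF', hF'P⟩ := exists_equivariant_choice hfree
    (fun (a : T.verts) (z : Y) => (∀ γ : Γ, a = γ • v → z = ψ γ p) ∧
      ((∀ γ : Γ, a ≠ γ • v) → z = F a))
    (by
      rintro γ a z ⟨h1, h2⟩
      refine ⟨fun δ hδ => ?_, fun h => ?_⟩
      · change ψ γ z = _
        rw [h1 (γ⁻¹ * δ) (by rw [mul_smul, ← hδ, inv_smul_smul]), ← IsometryEquiv.mul_apply,
          ← map_mul, mul_inv_cancel_left]
      · change ψ γ z = _
        rw [hF, h2 fun δ hδ => h (γ * δ) (by rw [hδ, mul_smul])])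
    (by
      intro a
      by_cases h : ∃ γ : Γ, a = γ • v
      · obtain ⟨γ, rfl⟩ := h
        refine ⟨ψ γ p, fun δ hδ => ?_, fun h => absurd rfl (h γ)⟩
        have : γ⁻¹ * δ = 1 := hfree _ v (by rw [mul_smul, ← hδ, inv_smul_smul])
        rw [inv_mul_eq_one.1 this]
      · push Not at h
        exact ⟨F a, fun γ hγ => absurd hγ (h γ), fun _ => rfl⟩)
  have hequiv : ∀ (γ : Γ) a, F' (γ • a) = ψ γ (F' a) := hF'
  have hv : F' v = p := by simpa using (hF'P v).1 1 (one_smul _ v).symm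
  have strict : ∀ b, T.graph.Adj v b → dist (F' v) (F' b) < C * dist (v : X) b := by
    intro b hb
    by_cases horb : ∃ γ : Γ, b = γ • v
    · obtain ⟨γ, rfl⟩ := horb
      rw [hequiv, hv]
      have hγp : dist (ψ γ p) (ψ γ (F v)) = ε := by
        rw [IsometryEquiv.dist_eq, dist_comm, hp1]
      by_cases ht : T.IsTight F C v (γ • v)
      · -- both ends move, each of them towards the other one
        have h1 := fact _ ht
        have ht' : T.IsTight F C v (γ⁻¹ • v) := by
          rw [← isTight_smul hF γ, smul_inv_smul]; exact ht.symm
        have h2 := fact _ ht'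
        have h3 := htight _ ht
        have e1 := (ψ γ).dist_eq p (F (γ⁻¹ • v))
        have e2 := (ψ γ).dist_eq (F v) (F (γ⁻¹ • v))
        rw [show ψ γ (F (γ⁻¹ • v)) = F v by rw [← hF, smul_inv_smul]] at e1 e2
        have h4 := ht.2
        rw [hF] at h1 h3 h4
        rcases hY.fourPoint_or p (ψ γ p) (F v) (ψ γ (F v)) with h | h <;>
          linarith [dist_comm p (F v), dist_comm (ψ γ (F v)) (F v),
            dist_triangle (F w) (ψ γ (F v)) (F v)]
      · have h1 := hloose _ hb ht
        rw [hF] at h1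
        linarith [dist_triangle4 p (F v) (ψ γ (F v)) (ψ γ p), dist_comm p (F v),
          dist_comm (ψ γ p) (ψ γ (F v))]
    · push Not at horb
      rw [hv, (hF'P b).2 horb]
      by_cases ht : T.IsTight F C v b
      · linarith [fact b ht, ht.2]
      · linarith [hloose b hb ht, dist_triangle p (F v) (F b), dist_comm p (F v)]
  have strict_orbit : ∀ (γ : Γ) a b, a = γ • v → T.graph.Adj a b →
      dist (F' a) (F' b) < C * dist (a : X) b := by
    rintro γ a b rfl hab
    obtain ⟨b, rfl⟩ : ∃ b', b = γ • b' := ⟨γ⁻¹ • b, (smul_inv_smul γ b).symm⟩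
    simpa only [hequiv, coe_smul_subgroup, IsometryEquiv.dist_eq] using
      strict b ((adj_smul (γ : T.Isom)).1 hab)
  have dichotomy : ∀ a b, T.graph.Adj a b → dist (F' a) (F' b) < C * dist (a : X) b ∨
      (F' a = F a ∧ F' b = F b) := by
    intro a b hab
    by_cases ha : ∃ γ : Γ, a = γ • v
    · obtain ⟨γ, hγ⟩ := ha
      exact Or.inl (strict_orbit γ a b hγ hab)
    by_cases hb : ∃ γ : Γ, b = γ • v
    · obtain ⟨γ, hγ⟩ := hb
      left
      rw [dist_comm, dist_comm (a : X)]
      exact strict_orbit γ b a hγ hab.symm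
    push Not at ha hb
    exact Or.inr ⟨(hF'P a).2 ha, (hF'P b).2 hb⟩
  refine ⟨F', hequiv, fun a b hab => ?_, fun a b hab => ?_, fun h => (strict w h.1).ne h.2⟩
  · rcases dichotomy a b hab with h | ⟨h1, h2⟩
    · exact h.le
    · rw [h1, h2]; exact hFC a b hab
  · rcases dichotomy a b hab.1 with h | ⟨h1, h2⟩
    · exact absurd hab.2 h.ne
    · exact ⟨hab.1, by rw [← h1, ← h2]; exact hab.2⟩

/-- Among the equivariant maps stretching no edge by more than `C`, one with the least number of
orbits of tight edges has tight continuations. -/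
theorem exists_hasTightContinuations (hY : IsRealTree Y) (hfin : T.LocallyFinite)
    {Γ : Subgroup T.Isom} [Finite (T.QuotientEdges Γ)]
    (hfree : ∀ (γ : Γ) (v : T.verts), γ • v = v → γ = 1) (ψ : Γ →* (Y ≃ᵢ Y)) {C : ℝ}
    (F : T.verts → Y) (hF : ∀ (γ : Γ) v, F (γ • v) = ψ γ (F v))
    (hFC : ∀ v w, T.graph.Adj v w → dist (F v) (F w) ≤ C * dist (v : X) w) :
    ∃ F : T.verts → Y, (∀ (γ : Γ) v, F (γ • v) = ψ γ (F v)) ∧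
      (∀ v w, T.graph.Adj v w → dist (F v) (F w) ≤ C * dist (v : X) w) ∧
      T.HasTightContinuations F C := by
  let tight : (T.verts → Y) → Set (T.QuotientEdges Γ) := fun F =>
    Quotient.mk (T.edgeSetoid Γ) '' {d | T.IsTight F C d.fst d.snd}
  induction hn : (tight F).ncard using Nat.strong_induction_on generalizing F with
  | _ n ih =>
    by_cases h : T.HasTightContinuations F C
    · exact ⟨F, hF, hFC, h⟩
    simp only [HasTightContinuations, not_forall, not_exists, not_and] at h
    obtain ⟨v, w, hvw, hfold⟩ := h
    obtain ⟨F', h1, h2, h3, h4⟩ := exists_less_tight hY hfin hfree ψ hF hFC hvw hfold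
    refine ih _ ?_ F' h1 h2 rfl
    rw [← hn]
    have hmem : Quotient.mk (T.edgeSetoid Γ) ⟨(v, w), hvw.1⟩ ∈ tight F := ⟨_, hvw, rfl⟩
    refine Set.ncard_lt_ncard (ssubset_of_subset_of_ne (Set.image_mono fun d hd => h3 _ _ hd)
      fun e => ?_) (Set.toFinite _)
    obtain ⟨d, hd, hdq⟩ : Quotient.mk (T.edgeSetoid Γ) ⟨(v, w), hvw.1⟩ ∈ tight F' := e ▸ hmem
    obtain ⟨γ, hγ, k1, k2⟩ := Quotient.exact hdq
    have e1 : (⟨γ, hγ⟩ : Γ) • d.fst = v := Subtype.ext k1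
    have e2 : (⟨γ, hγ⟩ : Γ) • d.snd = w := Subtype.ext k2
    apply h4
    rw [← e1, ← e2, isTight_smul h1]
    exact hd

/-- Extraction of an axis. Follow tight edges along legal turns, at every vertex choosing between
two tight edges fixed in advance (equivariantly) and leaving in different directions. This is
a deterministic walk on (vertex, choice) pairs, of which there are `2N` modulo `Γ`. So it becomes
periodic modulo `Γ` after at most `2N` edges, and its period `γ` translates a geodesic of `Y`. -/
theorem exists_tight_axis (hY : IsRealTree Y) {Γ : Subgroup T.Isom} [Finite (T.QuotientVerts Γ)]
    (hfree : ∀ (γ : Γ) (v : T.verts), γ • v = v → γ = 1) (ψ : Γ →* (Y ≃ᵢ Y)) {C : ℝ}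
    (hC : 0 < C) (F : T.verts → Y) (hF : ∀ (γ : Γ) v, F (γ • v) = ψ γ (F v))
    (hcont : T.HasTightContinuations F C) (hne : ∃ v w, T.IsTight F C v w) :
    ∃ γ : Γ, γ ≠ 1 ∧ ∃ (v : T.verts) (ℓ : ℝ), dist (v : X) ((γ • v : T.verts) : X) ≤ ℓ ∧
      (∀ L : ℝ, (∀ v w : T.verts, T.graph.Adj v w → dist (v : X) w ≤ L) →
        ℓ ≤ 2 * (Nat.card (T.QuotientVerts Γ) : ℝ) * L) ∧
      ∀ y, C * ℓ ≤ dist y (ψ γ y) := by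
  classical
  obtain ⟨δ, hδ, hδP⟩ := exists_equivariant_choice hfree
    (fun (v : T.verts) (z : Bool → T.verts) => (∃ w, T.IsTight F C v w) →
      (∀ i, T.IsTight F C v (z i)) ∧ IsLegalTurn F (z false) v (z true))
    (by
      rintro γ v z h ⟨w, hw⟩
      obtain ⟨h1, h2⟩ := h ⟨γ⁻¹ • w, by rwa [← isTight_smul hF γ, smul_inv_smul]⟩
      exact ⟨fun i => (isTight_smul hF γ).2 (h1 i), (isLegalTurn_smul hF γ).2 h2⟩)
    (by
      intro v
      by_cases h : ∃ w, T.IsTight F C v w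
      · obtain ⟨w, hw⟩ := h
        obtain ⟨w', hw', hl⟩ := hcont v w hw
        exact ⟨fun i => bif i then w' else w, fun _ =>
          ⟨fun i => by cases i; exacts [hw, hw'], hl⟩⟩
      · exact ⟨fun _ => v, fun h' => absurd h' h⟩)
  have hδ' : ∀ (γ : Γ) v i, δ (γ • v) i = γ • δ v i := fun γ v i => by rw [hδ]; rfl
  -- coming from `u`, at least one of the two edges at `v` can be taken without folding
  have hchoice : ∀ u v, T.IsTight F C v u →
      IsLegalTurn F u v (δ v false) ∨ IsLegalTurn F u v (δ v true) := by
    intro u v huv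
    have hl := (hδP v ⟨u, huv⟩).2
    by_contra! h
    have h1 := lt_of_le_of_ne (dist_triangle _ _ _) h.1
    have h2 := lt_of_le_of_ne (dist_triangle _ _ _) h.2
    simp only [IsLegalTurn] at hl
    rcases hY.fourPoint_or (F (δ v false)) (F (δ v true)) (F u) (F v) with h | h <;>
      linarith [dist_comm (F (δ v false)) (F u), dist_comm (F (δ v true)) (F v),
        dist_comm (F (δ v false)) (F v), dist_comm (F (δ v true)) (F u)]
  let next : T.verts × Bool → T.verts × Bool := fun s =>
    (δ s.1 s.2, if IsLegalTurn F s.1 (δ s.1 s.2) (δ (δ s.1 s.2) false) then false else true)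
  have hnext : ∀ (γ : Γ) v i, next (γ • v, i) = (γ • (next (v, i)).1, (next (v, i)).2) := by
    intro γ v i
    simp only [next, hδ', isLegalTurn_smul hF]
  obtain ⟨v₀, w₀, hv₀⟩ := hne
  let s : ℕ → T.verts × Bool := fun k => next^[k] (v₀, false)
  have hs : ∀ k, s (k + 1) = next (s k) := fun k => Function.iterate_succ_apply' _ _ _
  have htight : ∀ k, T.IsTight F C (s k).1 (s (k + 1)).1 := by
    intro k
    rw [hs]
    induction k with
    | zero => exact (hδP _ ⟨w₀, hv₀⟩).1 _
    | succ k ih =>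
      rw [← hs] at ih
      exact (hδP _ ⟨_, ih.symm⟩).1 _
  have hlegal : ∀ k, IsLegalTurn F (s k).1 (s (k + 1)).1 (s (k + 2)).1 := by
    intro k
    have h := hchoice _ _ (htight k).symm
    rw [hs (k + 1), hs k] at *
    simp only [next] at *
    split_ifs with h'
    · exact h'
    · exact h.resolve_left h'
  -- two states agree modulo `Γ`
  have hN : 0 < Nat.card (T.QuotientVerts Γ) :=
    have : Nonempty (T.QuotientVerts Γ) := ⟨Quotient.mk _ v₀⟩
    Nat.card_pos
  obtain ⟨k, l, hkl, hl, γ, hγ, hi⟩ : ∃ k l, k < l ∧ l ≤ 2 * Nat.card (T.QuotientVerts Γ) ∧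
      ∃ γ : Γ, γ • (s k).1 = (s l).1 ∧ (s k).2 = (s l).2 := by
    let cls : Fin (2 * Nat.card (T.QuotientVerts Γ) + 1) → T.QuotientVerts Γ × Bool :=
      fun k => (Quotient.mk (T.vertexSetoid Γ) (s k).1, (s k).2)
    have hnot : ¬ Function.Injective cls := by
      intro h
      have := Nat.card_le_card_of_injective cls h
      simp only [Nat.card_prod, Nat.card_fin, Nat.card_eq_fintype_card (α := Bool),
        Fintype.card_bool] at this
      omega
    simp only [Function.Injective, not_forall] at hnot
    obtain ⟨a, b, hab, hne⟩ := hnot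
    have main : ∀ a b : Fin (2 * Nat.card (T.QuotientVerts Γ) + 1), cls a = cls b →
        ∃ γ : Γ, γ • (s a).1 = (s b).1 ∧ (s a).2 = (s b).2 := by
      intro a b h
      obtain ⟨γ, hγ, e⟩ := Quotient.exact (congrArg Prod.fst h)
      exact ⟨⟨γ, hγ⟩, Subtype.ext e, (congrArg Prod.snd h :)⟩
    rcases lt_or_gt_of_ne (fun h => hne (Fin.ext h) : (a : ℕ) ≠ b) with h | h
    · exact ⟨a, b, h, by omega, main a b hab⟩
    · exact ⟨b, a, h, by omega, main b a hab.symm⟩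
  obtain ⟨m, rfl⟩ := Nat.exists_eq_add_of_lt hkl
  have hper : ∀ n, s (k + m + 1 + n) = (γ • (s (k + n)).1, (s (k + n)).2) := by
    intro n
    induction n with
    | zero => exact Prod.ext hγ.symm hi.symm
    | succ n ih => rw [← add_assoc, hs, ih, hnext, ← add_assoc, hs]
  let p : ℕ → T.verts := fun n => (s (k + n)).1
  have hp : ∀ n, p (m + 1 + n) = γ • p n := fun n => by
    change (s (k + (m + 1 + n))).1 = _
    rw [← add_assoc, ← add_assoc, hper]
  let ℓ : ℝ := ∑ n ∈ Finset.range (m + 1), dist (p n : X) (p (n + 1))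
  have hstep : ∀ n, dist (F (p n)) (F (p (n + 1))) = C * dist (p n : X) (p (n + 1)) :=
    fun n => (htight (k + n)).2
  have hgeo := hY.dist_eq_sum (fun n => F (p n))
    (fun n => dist_pos.1 (by
      rw [hstep]; exact mul_pos hC (dist_pos_of_adj (htight (k + n)).1)))
    (fun n => hlegal (k + n))
  have h1 : dist (F (p 0)) (ψ γ (F (p 0))) = C * ℓ := by
    rw [← hF, ← hp 0]
    refine (hgeo _).trans ?_
    simp only [hstep, ℓ, Finset.mul_sum]
  have h2 : dist (F (p 0)) (ψ γ (ψ γ (F (p 0)))) = C * ℓ + C * ℓ := by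
    rw [← hF, ← hF, ← hp 0, ← hp]
    refine (hgeo _).trans ?_
    rw [add_zero, Finset.sum_range_add]
    simp only [hstep, ℓ, Finset.mul_sum]
    congr 1
    refine Finset.sum_congr rfl fun n _ => ?_
    rw [add_assoc (m + 1) n 1, hp, hp, coe_smul_subgroup, coe_smul_subgroup,
      IsometryEquiv.dist_eq]
  have hdisp : ∀ y, C * ℓ ≤ dist y (ψ γ y) := fun y => by
    linarith [hY.dist_sq_le (ψ γ) (F (p 0)) y]
  have hℓ : 0 < ℓ := Finset.sum_pos (fun n _ => dist_pos_of_adj (htight (k + n)).1) (by simp)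
  refine ⟨γ, ?_, p 0, ℓ, ?_, ?_, hdisp⟩
  · rintro rfl
    have := hdisp (F v₀)
    rw [map_one, IsometryEquiv.coe_one, id, dist_self] at this
    linarith [mul_pos hC hℓ]
  · rw [← hp 0]
    exact dist_le_range_sum_dist (fun n => (p n : X)) (m + 1)
  · intro L hL
    have hL0 : 0 ≤ L := dist_nonneg.trans (hL _ _ hv₀.1)
    have h3 : ℓ ≤ ∑ n ∈ Finset.range (m + 1), L :=
      Finset.sum_le_sum fun n _ => hL _ _ (htight (k + n)).1
    rw [Finset.sum_const, Finset.card_range, nsmul_eq_mul] at h3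
    refine h3.trans (mul_le_mul_of_nonneg_right ?_ hL0)
    exact_mod_cast (by omega : m + 1 ≤ 2 * Nat.card (T.QuotientVerts Γ))

end SimplicialRealTree

namespace SimplicialRealTree

variable {X X' : Type*} [MetricSpace X] [MetricSpace X'] {T : SimplicialRealTree X}
  {T' : SimplicialRealTree X'}

/-! ### Diameter of the quotient graph -/

/-- The simple graph underlying `Γ\X`: its vertices are the orbits of vertices, two distinct orbits
being adjacent if they contain adjacent vertices. -/
def quotientGraph (T : SimplicialRealTree X) (Γ : Subgroup T.Isom) :
    SimpleGraph (T.QuotientVerts Γ) where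
  Adj a b := a ≠ b ∧ ∃ v w : T.verts, T.graph.Adj v w ∧
    Quotient.mk (T.vertexSetoid Γ) v = a ∧ Quotient.mk (T.vertexSetoid Γ) w = b
  symm := ⟨fun _ _ ⟨hne, v, w, h, hv, hw⟩ => ⟨hne.symm, w, v, h.symm, hw, hv⟩⟩
  loopless := ⟨fun _ h => h.1 rfl⟩

theorem exists_smul_eq_of_mk_eq {Γ : Subgroup T.Isom} {v w : T.verts}
    (h : Quotient.mk (T.vertexSetoid Γ) v = Quotient.mk (T.vertexSetoid Γ) w) :
    ∃ γ : Γ, γ • v = w := by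
  obtain ⟨γ, hγ, e⟩ := Quotient.exact h
  exact ⟨⟨γ, hγ⟩, Subtype.ext e⟩

theorem mk_smul {Γ : Subgroup T.Isom} (γ : Γ) (v : T.verts) :
    Quotient.mk (T.vertexSetoid Γ) (γ • v) = Quotient.mk (T.vertexSetoid Γ) v :=
  (Quotient.sound (s := T.vertexSetoid Γ) ⟨γ, γ.2, rfl⟩).symm

theorem quotientGraph_reachable (Γ : Subgroup T.Isom) {v w : T.verts} (p : T.graph.Walk v w) :
    (T.quotientGraph Γ).Reachable (Quotient.mk _ v) (Quotient.mk _ w) := by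
  induction p with
  | nil => rfl
  | @cons a b c hab p ih =>
    by_cases h : Quotient.mk (T.vertexSetoid Γ) a = Quotient.mk _ b
    · rwa [h]
    · have hadj : (T.quotientGraph Γ).Adj (Quotient.mk _ a) (Quotient.mk _ b) :=
        ⟨h, a, b, hab, rfl, rfl⟩
      exact hadj.reachable.trans ih

/-- A walk in the quotient graph lifts to the tree, starting at any given vertex. -/
theorem exists_lift_dist_le {Γ : Subgroup T.Isom} {L : ℝ}
    (hL : ∀ v w : T.verts, T.graph.Adj v w → dist (v : X) w ≤ L) {a b : T.QuotientVerts Γ}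
    (p : (T.quotientGraph Γ).Walk a b) (u : T.verts) (hu : Quotient.mk _ u = a) :
    ∃ w : T.verts, Quotient.mk _ w = b ∧ dist (u : X) w ≤ p.length * L := by
  induction p generalizing u with
  | nil => exact ⟨u, hu, by simp⟩
  | cons hab p ih =>
    obtain ⟨-, v, w, hvw, hv, hw⟩ := hab
    obtain ⟨γ, rfl⟩ := exists_smul_eq_of_mk_eq (hv.trans hu.symm)
    obtain ⟨w', h1, h2⟩ := ih (γ • w) ((mk_smul γ w).trans hw)
    refine ⟨w', h1, ?_⟩
    have h3 := hL _ _ ((adj_smul (γ : T.Isom)).2 hvw)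
    change _ ≤ ((p.length + 1 : ℕ) : ℝ) * L
    push_cast
    have h4 := dist_triangle ((γ • v : T.verts) : X) ((γ • w : T.verts) : X) w'
    change dist ((γ • v : T.verts) : X) ((γ • w : T.verts) : X) ≤ L at h3
    linarith

theorem exists_dist_smul_le {Γ : Subgroup T.Isom} [Finite (T.QuotientVerts Γ)] {L : ℝ}
    (hL0 : 0 ≤ L) (hL : ∀ v w : T.verts, T.graph.Adj v w → dist (v : X) w ≤ L) (u v : T.verts) :
    ∃ γ : Γ, dist (u : X) ((γ • v : T.verts) : X) ≤
      ((Nat.card (T.QuotientVerts Γ) : ℝ) - 1) * L := by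
  classical
  obtain ⟨q⟩ := T.isTree.connected.preconnected u v
  obtain ⟨p, hp⟩ := (quotientGraph_reachable Γ q).exists_isPath
  obtain ⟨w, hw, hd⟩ := exists_lift_dist_le hL p u rfl
  obtain ⟨γ, rfl⟩ := exists_smul_eq_of_mk_eq hw.symm
  refine ⟨γ, hd.trans (mul_le_mul_of_nonneg_right ?_ hL0)⟩
  have := Fintype.ofFinite (T.QuotientVerts Γ)
  have hlt := hp.length_lt
  rw [← Nat.card_eq_fintype_card] at hlt
  have : ((p.length + 1 : ℕ) : ℝ) ≤ Nat.card (T.QuotientVerts Γ) := by exact_mod_cast hlt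
  push_cast at this
  linarith

/-- An element displacing some vertex by at most `2NL` has a conjugate displacing `x₀` by at most
`4NL`. -/
theorem exists_conj_mem_smallDisplacement (hT : T.ValenceGeTwo) {Γ : Subgroup T.Isom}
    [Finite (T.QuotientVerts Γ)] {L : ℝ}
    (hL : ∀ v w : T.verts, T.graph.Adj v w → dist (v : X) w ≤ L) (x₀ : X) {γ : Γ} (hγ : γ ≠ 1)
    {v : T.verts} (hv : dist (v : X) ((γ • v : T.verts) : X) ≤
      2 * (Nat.card (T.QuotientVerts Γ) : ℝ) * L) :
    ∃ h : Γ, h * γ * h⁻¹ ∈ smallDisplacement Γ x₀ (4 * (Nat.card (T.QuotientVerts Γ) : ℝ) * L) := by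
  obtain ⟨a, b, hab, hx₀⟩ := hT.exists_edge x₀
  have hlen := hL a b hab
  have hL0 : 0 ≤ L := dist_nonneg.trans hlen
  have hx₀' : dist (a : X) x₀ + dist x₀ b = dist (a : X) b := hx₀
  obtain ⟨u, hu⟩ : ∃ u : T.verts, dist x₀ (u : X) ≤ L / 2 := by
    rcases le_total (dist (a : X) x₀) (dist x₀ b) with h | h
    · exact ⟨a, by rw [dist_comm]; linarith⟩
    · exact ⟨b, by linarith⟩
  obtain ⟨h, hh⟩ := exists_dist_smul_le (Γ := Γ) hL0 hL u v
  refine ⟨h, by simpa [mul_inv_eq_one] using hγ, ?_⟩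
  have h1 : dist x₀ ((h • v : T.verts) : X) ≤
      L / 2 + ((Nat.card (T.QuotientVerts Γ) : ℝ) - 1) * L := by
    linarith [dist_triangle x₀ (u : X) ((h • v : T.verts) : X)]
  have h2 : dist ((h • v : T.verts) : X) (((h * γ) • v : T.verts) : X) =
      dist (v : X) ((γ • v : T.verts) : X) := by
    rw [mul_smul]; exact dist_smul_smul (h : T.Isom) _ _
  have h3 : dist (((h * γ) • v : T.verts) : X) ((((h * γ * h⁻¹ : Γ) : T.Isom) : X ≃ᵢ X) x₀) =
      dist ((h • v : T.verts) : X) x₀ := by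
    have e : (h * γ) • v = (h * γ * h⁻¹) • h • v := by rw [smul_smul, inv_mul_cancel_right]
    rw [e]
    exact (((h * γ * h⁻¹ : Γ) : T.Isom) : X ≃ᵢ X).dist_eq _ _
  have h4 := dist_triangle4 x₀ ((h • v : T.verts) : X) (((h * γ) • v : T.verts) : X)
    ((((h * γ * h⁻¹ : Γ) : T.Isom) : X ≃ᵢ X) x₀)
  have h5 := dist_comm x₀ ((h • v : T.verts) : X)
  linarith

/-! ### Optimal equivariant maps -/

/-- If no translation length grows by more than the factor `C`, then some equivariant map on the
vertices stretches no edge by more than `C`: a finite quotient leaves only finitely many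
conditions to be met. -/
theorem exists_equivariant_le {Y : Type*} [MetricSpace Y]
    (hY : IsRealTree Y) [Nonempty Y] {Γ : Subgroup T.Isom}
    [Finite (T.QuotientVerts Γ)] [Finite (T.QuotientEdges Γ)]
    (hfree : ∀ (γ : Γ) (v : T.verts), γ • v = v → γ = 1) (ψ : Γ →* (Y ≃ᵢ Y)) {C : ℝ}
    (hC : 0 ≤ C)
    (hdisp : ∀ (γ : Γ) x, ∃ q, dist q (ψ γ q) ≤ C * dist x (((γ : T.Isom) : X ≃ᵢ X) x)) :
    ∃ F : T.verts → Y, (∀ (γ : Γ) v, F (γ • v) = ψ γ (F v)) ∧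
      ∀ v w, T.graph.Adj v w → dist (F v) (F w) ≤ C * dist (v : X) w := by
  classical
  have := Fintype.ofFinite (T.QuotientVerts Γ)
  let rep : T.QuotientVerts Γ → T.verts := Quotient.out
  have hrep : ∀ v : T.verts, ∃ γ : Γ, γ • rep (Quotient.mk _ v) = v := fun v =>
    exists_smul_eq_of_mk_eq (Quotient.out_eq _)
  choose g hg using hrep
  let K : Set Γ := Set.range fun e : T.QuotientEdges Γ => (g e.out.fst)⁻¹ * g e.out.snd
  obtain ⟨y, hy⟩ := hY.exists_equivariant_contraction (T.Isom.subtype.comp Γ.subtype) ψ hC hdisp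
    (fun q => (rep q : X)) Finset.univ K (Set.finite_range _)
  let _ : MulAction Γ Y := isometryAction ψ
  obtain ⟨F, hF, hFP⟩ := exists_equivariant_choice hfree
    (fun (v : T.verts) (z : Y) => z = ψ (g v) (y (Quotient.mk _ v)))
    (by
      rintro γ v z rfl
      have h1 := hg (γ • v)
      rw [mk_smul] at h1
      have h2 : (γ * g v)⁻¹ * g (γ • v) = 1 := hfree _ (rep (Quotient.mk _ v)) (by
        rw [mul_smul, h1, inv_smul_eq_iff, mul_smul, hg])
      rw [← inv_mul_eq_one.1 h2, mk_smul, map_mul]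
      rfl)
    (fun v => ⟨_, rfl⟩)
  have hF' : ∀ (γ : Γ) v, F (γ • v) = ψ γ (F v) := hF
  refine ⟨F, hF', fun v w hvw => ?_⟩
  -- it suffices to look at the representatives of the edge orbits
  let d : T.graph.Dart := ⟨(v, w), hvw⟩
  let e : T.QuotientEdges Γ := Quotient.mk _ d
  obtain ⟨γ, hγ, k1, k2⟩ := Quotient.exact (Quotient.out_eq e)
  have e1 : (⟨γ, hγ⟩ : Γ) • e.out.fst = v := Subtype.ext k1
  have e2 : (⟨γ, hγ⟩ : Γ) • e.out.snd = w := Subtype.ext k2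
  have hrepr : dist (F e.out.fst) (F e.out.snd) ≤ C * dist (e.out.fst : X) e.out.snd := by
    have h := hy (Quotient.mk _ e.out.fst) (Finset.mem_univ _) (Quotient.mk _ e.out.snd)
      (Finset.mem_univ _) _ ⟨e, rfl⟩
    have h1 := (ψ (g e.out.fst)).dist_eq (y (Quotient.mk _ e.out.fst))
      (ψ ((g e.out.fst)⁻¹ * g e.out.snd) (y (Quotient.mk _ e.out.snd)))
    rw [← IsometryEquiv.mul_apply, ← map_mul, mul_inv_cancel_left, ← hFP, ← hFP] at h1
    rw [← h1] at h
    refine h.trans_eq (congrArg _ ?_)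
    have h2 := dist_smul_smul (g e.out.fst : T.Isom) (rep (Quotient.mk _ e.out.fst))
      (((g e.out.fst)⁻¹ * g e.out.snd) • rep (Quotient.mk _ e.out.snd))
    change dist ((g e.out.fst • rep (Quotient.mk _ e.out.fst) : T.verts) : X)
      ((g e.out.fst • (((g e.out.fst)⁻¹ * g e.out.snd) •
        rep (Quotient.mk _ e.out.snd)) : T.verts) : X) = _ at h2
    rw [smul_smul, mul_inv_cancel_left, hg, hg] at h2
    exact h2.symm
  rw [← e1, ← e2, hF', hF', (ψ _).dist_eq]
  refine hrepr.trans_eq (congrArg _ ?_)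
  exact (dist_smul_smul γ _ _).symm

/-- In a tree of valence at least two the identity map has tight continuations: every edge
path can be continued without backtracking. -/
theorem hasTightContinuations_coe (hT : T.ValenceGeTwo) :
    T.HasTightContinuations (fun v => (v : X)) 1 := by
  intro v w hvw
  obtain ⟨w', hne, hw'⟩ : ∃ w', w ≠ w' ∧ T.graph.Adj v w' := by
    obtain ⟨w₁, w₂, h12, h1, h2⟩ := hT v
    by_cases h : w = w₁
    · exact ⟨w₂, h ▸ h12, h2⟩
    · exact ⟨w₁, h, h1⟩
  refine ⟨w', ⟨hw', (one_mul _).symm⟩, ?_⟩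
  have hp : (SimpleGraph.Walk.cons hvw.1.symm (.cons hw' .nil)).IsPath := by
    simp [hvw.1.ne', hw'.ne, hne]
  have := T.dist_verts _ _ _ hp
  simpa [IsLegalTurn] using this

/-- An equivariant `K`-Lipschitz map multiplies translation lengths by at most `K`. -/
theorem translationLength_le_mul {Γ : Subgroup T.Isom} {ρ : Γ →* T'.Isom} {f : X → X'}
    (hf : Equivariant ρ f) {K : ℝ≥0} (hK : LipschitzWith K f) (γ : Γ) :
    translationLength (ρ γ) ≤ K * translationLength (γ : T.Isom) := by
  obtain ⟨q, hq⟩ := exists_dist_eq_translationLength (γ : T.Isom)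
  rw [← hq]
  refine (translationLength_le _ (f q)).trans ?_
  rw [← hf]
  exact hK.dist_le_mul _ _

end SimplicialRealTree

/-! ### The optimal Lipschitz constant and the translation lengths -/

open SimplicialRealTree in
theorem proposition4p1 {X X' : Type*} [MetricSpace X] [MetricSpace X']
    (T : SimplicialRealTree X) (T' : SimplicialRealTree X')
    (hT : T.ValenceGeTwo) (hT' : T'.ValenceGeTwo) (hTfin : T.LocallyFinite)
    (Γ₀ : Subgroup T.Isom) (hdiscrete : DiscreteTopology Γ₀)
    (htorsion : ∀ γ : Γ₀, IsOfFinOrder γ → γ = 1)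
    (hquotV : Finite (T.QuotientVerts Γ₀)) (hquotE : Finite (T.QuotientEdges Γ₀))
    (ρ : Γ₀ →* T'.Isom) :
    -- existence of equivariant piecewise affine maps
    (∃ f : X → X', T.PiecewiseAffine f ∧ SimplicialRealTree.Equivariant ρ f) ∧
    -- each of them is Lipschitz
    (∀ f : X → X', T.PiecewiseAffine f → SimplicialRealTree.Equivariant ρ f →
      ∃ K : ℝ≥0, LipschitzWith K f) ∧
    -- the infimum `C` of the Lipschitz constants is attained
    ∃ C : ℝ≥0,
      IsLeast {K : ℝ≥0 | ∃ f : X → X', T.PiecewiseAffine f ∧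
        SimplicialRealTree.Equivariant ρ f ∧ LipschitzWith K f} C ∧
      -- the quotients of translation lengths make sense and their supremum is `C`
      (∀ γ : Γ₀, γ ≠ 1 → 0 < SimplicialRealTree.translationLength (γ : T.Isom)) ∧
      IsLUB {r : ℝ | ∃ γ : Γ₀, γ ≠ 1 ∧
        r = SimplicialRealTree.translationLength (ρ γ) /
          SimplicialRealTree.translationLength (γ : T.Isom)} (C : ℝ) ∧
      -- the supremum is attained on the finite set `F`
      1 ≤ Nat.card (T.QuotientVerts Γ₀) ∧
      ∀ (x₀ : X) (L : ℝ),
        (∀ v w : T.verts, T.graph.Adj v w → dist (v : X) (w : X) ≤ L) →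
        (SimplicialRealTree.smallDisplacement Γ₀ x₀
          (4 * (Nat.card (T.QuotientVerts Γ₀) : ℝ) * L)).Finite ∧
        IsGreatest ((fun γ : Γ₀ => SimplicialRealTree.translationLength (ρ γ) /
            SimplicialRealTree.translationLength (γ : T.Isom)) ''
          SimplicialRealTree.smallDisplacement Γ₀ x₀
            (4 * (Nat.card (T.QuotientVerts Γ₀) : ℝ) * L)) (C : ℝ) := by
  have hX' := T'.isRealTree
  have := T'.nonempty
  let ψ : Γ₀ →* (X' ≃ᵢ X') := T'.Isom.subtype.comp ρ
  have hfix : ∀ (γ : Γ₀) (x : X), ((γ : T.Isom) : X ≃ᵢ X) x = x → γ = 1 := fun γ x hx =>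
    eq_one_of_fixed_point hT hTfin Γ₀ htorsion hx
  have hfree : ∀ (γ : Γ₀) (v : T.verts), γ • v = v → γ = 1 := fun γ v hv =>
    hfix γ v (congrArg Subtype.val hv)
  have hpos : ∀ γ : Γ₀, γ ≠ 1 → 0 < translationLength (γ : T.Isom) := by
    intro γ hγ
    obtain ⟨q, hq⟩ := exists_dist_eq_translationLength (γ : T.Isom)
    rw [← hq]
    exact dist_pos.2 fun h => hγ (hfix γ q h.symm)
  have hLip : ∀ f : X → X', T.PiecewiseAffine f → Equivariant ρ f →
      ∃ K : ℝ≥0, LipschitzWith K f := fun f hf he => hf.exists_lipschitzWith hT ψ he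
  have hratio : ∀ (f : X → X') (K : ℝ≥0), Equivariant ρ f → LipschitzWith K f →
      ∀ γ : Γ₀, γ ≠ 1 → translationLength (ρ γ) / translationLength (γ : T.Isom) ≤ K :=
    fun f K he hK γ hγ => (div_le_iff₀ (hpos γ hγ)).2 (translationLength_le_mul he hK γ)
  obtain ⟨f₀, hf₀, he₀⟩ : ∃ f : X → X', T.PiecewiseAffine f ∧ Equivariant ρ f := by
    let _ : MulAction Γ₀ X' := isometryAction ψ
    obtain ⟨F, hF, -⟩ := exists_equivariant_choice (Z := X') hfree (fun _ _ => True)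
      (fun _ _ _ _ => trivial) (fun _ => ⟨Classical.arbitrary X', trivial⟩)
    obtain ⟨f, h1, h2, -⟩ := exists_piecewiseAffine_extension hX' hT ψ F hF
    exact ⟨f, h1, h2⟩
  obtain ⟨K₀, hK₀⟩ := hLip f₀ hf₀ he₀
  obtain ⟨a₀, b₀, hab₀⟩ : ∃ a b, T.graph.Adj a b := by
    obtain ⟨d⟩ := hT.nonempty_dart
    exact ⟨_, _, d.adj⟩
  -- the identity of `X` provides nontrivial elements of small displacement
  obtain ⟨γ₁, hγ₁, v₁, ℓ₁, hℓ₁, hℓ₁L, -⟩ := exists_tight_axis T.isRealTree hfree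
    (T.Isom.subtype.comp Γ₀.subtype) one_pos (fun v => (v : X)) (fun _ _ => rfl)
    (hasTightContinuations_coe hT) ⟨a₀, b₀, hab₀, (one_mul _).symm⟩
  set R : Set ℝ := {r : ℝ | ∃ γ : Γ₀, γ ≠ 1 ∧
    r = translationLength (ρ γ) / translationLength (γ : T.Isom)} with hR
  have hRlub : IsLUB R (sSup R) := isLUB_csSup ⟨_, γ₁, hγ₁, rfl⟩ ⟨K₀, by
    rintro _ ⟨γ, hγ, rfl⟩
    exact hratio f₀ K₀ he₀ hK₀ γ hγ⟩
  have hratio_nonneg : ∀ γ : Γ₀,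
      0 ≤ translationLength (ρ γ) / translationLength (γ : T.Isom) := fun γ =>
    div_nonneg (translationLength_nonneg _) (translationLength_nonneg _)
  have hC0 : 0 ≤ sSup R := Real.sSup_nonneg (by rintro _ ⟨γ, -, rfl⟩; exact hratio_nonneg γ)
  set C : ℝ≥0 := ⟨sSup R, hC0⟩
  have hRlub : IsLUB R (C : ℝ) := hRlub
  have hmin : ∀ (f : X → X') (K : ℝ≥0), Equivariant ρ f → LipschitzWith K f → C ≤ K :=
    fun f K he hK => NNReal.coe_le_coe.1 (hRlub.2 (by
      rintro _ ⟨γ, hγ, rfl⟩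
      exact hratio f K he hK γ hγ))
  have hdisp : ∀ (γ : Γ₀) x, ∃ q,
      dist q (ψ γ q) ≤ C * dist x (((γ : T.Isom) : X ≃ᵢ X) x) := by
    intro γ x
    obtain ⟨q, hq⟩ := exists_dist_eq_translationLength (ρ γ)
    refine ⟨q, hq.le.trans ?_⟩
    by_cases hγ : γ = 1
    · subst hγ
      rw [← hq, map_one]
      simp
    · exact ((div_le_iff₀ (hpos γ hγ)).1 (hRlub.1 ⟨γ, hγ, rfl⟩)).trans
        (mul_le_mul_of_nonneg_left (translationLength_le _ x) hC0)
  obtain ⟨F₀, hF₀, hF₀C⟩ := exists_equivariant_le hX' hfree ψ hC0 hdisp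
  obtain ⟨F, hF, hFC, hcont⟩ := exists_hasTightContinuations hX' hTfin hfree ψ F₀ hF₀ hF₀C
  obtain ⟨f, hf, he, hfF⟩ := exists_piecewiseAffine_extension hX' hT ψ F hF
  have hfC : LipschitzWith C f := hf.lipschitzWith hT fun v w hvw => by
    rw [hfF, hfF]; exact hFC v w hvw
  refine ⟨⟨f₀, hf₀, he₀⟩, hLip, C, ⟨⟨f, hf, he, hfC⟩, ?_⟩, hpos, hRlub, ?_, fun x₀ L hL => ?_⟩
  · rintro K ⟨f', -, he', hK'⟩
    exact hmin f' K he' hK'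
  · have : Nonempty (T.QuotientVerts Γ₀) := ⟨Quotient.mk _ a₀⟩
    exact Nat.card_pos
  refine ⟨(finite_dist_le hT hTfin Γ₀ x₀ _).subset fun γ hγ => hγ.2, ?_, ?_⟩
  · -- a short element that realizes the ratio `C`; its conjugates do so as well
    obtain ⟨γ, hγ, v, hv, hge⟩ : ∃ γ : Γ₀, γ ≠ 1 ∧ ∃ v : T.verts,
        dist (v : X) ((γ • v : T.verts) : X) ≤ 2 * (Nat.card (T.QuotientVerts Γ₀) : ℝ) * L ∧
        (C : ℝ) ≤ translationLength (ρ γ) / translationLength (γ : T.Isom) := by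
      rcases hC0.eq_or_lt with hC | hC
      · exact ⟨γ₁, hγ₁, v₁, hℓ₁.trans (hℓ₁L L hL), (hratio_nonneg γ₁).trans' hC.ge⟩
      have hne : ∃ v w, T.IsTight F C v w := by
        obtain ⟨a, b, hab, hmax⟩ := exists_max_on_edges hT Γ₀
          (fun v w => dist (F v) (F w) / dist (v : X) w) (fun γ v w _ => by
            simp only [coe_smul_subgroup, hF, IsometryEquiv.dist_eq])
        have hfK : LipschitzWith ⟨dist (F a) (F b) / dist (a : X) b, by positivity⟩ f :=
          hf.lipschitzWith hT fun v w hvw => by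
            rw [hfF, hfF]
            exact (div_le_iff₀ (dist_pos_of_adj hvw)).1 (hmax v w hvw)
        have h : (C : ℝ) ≤ dist (F a) (F b) / dist (a : X) b := hmin f _ he hfK
        exact ⟨a, b, hab, le_antisymm (hFC a b hab) ((le_div_iff₀ (dist_pos_of_adj hab)).1 h)⟩
      obtain ⟨γ, hγ, v, ℓ, hvℓ, hℓL, hℓ⟩ := exists_tight_axis hX' hfree ψ hC F hF hcont hne
      refine ⟨γ, hγ, v, hvℓ.trans (hℓL L hL), (le_div_iff₀ (hpos γ hγ)).2 ?_⟩
      exact (mul_le_mul_of_nonneg_left ((translationLength_le _ _).trans hvℓ) hC0).trans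
        (le_translationLength hℓ)
    obtain ⟨h, hh⟩ := exists_conj_mem_smallDisplacement hT hL x₀ hγ hv
    refine ⟨h * γ * h⁻¹, hh, ?_⟩
    have e1 : translationLength (ρ (h * γ * h⁻¹)) = translationLength (ρ γ) := by
      rw [map_mul, map_mul, map_inv, translationLength_conj]
    have e2 : translationLength ((h * γ * h⁻¹ : Γ₀) : T.Isom) =
        translationLength (γ : T.Isom) := by
      rw [Subgroup.coe_mul, Subgroup.coe_mul, Subgroup.coe_inv, translationLength_conj]
    change _ / _ = _
    rw [e1, e2]
    exact le_antisymm (hRlub.1 ⟨γ, hγ, rfl⟩) hge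
  · rintro _ ⟨γ, hγ, rfl⟩
    exact hRlub.1 ⟨γ, hγ.1, rfl⟩
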